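/- **Setting.** A *pointed indexing category* is a small connected category $\mathcal J$ with finite Hom-sets and a degree function $|\cdot|:\mathrm{Obj}\,\mathcal J\to\mathbb N$ such that each degree contains finitely many objects, all non-identity morphisms strictly lower degree, and every object maps to one of degree $0$, together with a partition $\mathrm{Mor}(\mathcal J)=\widetilde{\mathbf J}\sqcup\overline{\mathcal J}$ in which $\overline{\mathcal J}$ (the *null* maps) is closed under composition with arbitrary morphisms on either side and contains $\mathrm{Id}_x$ if and only if $x$ is a zero object of $\mathcal J$. It is *fully reduced* if every morphism lowering degree by at least $2$ is null. Let $\mathcal E_*$ be a model category with a zero object, $\mathcal J_n$ the full subcategory of objects of degree $\le n$, and $Y:\mathcal J_n\to\mathcal E_*$ a functor sending null maps to zero maps. For $m\ge -1$ let $M_x^m$ be the limit of $(x\to t)\mapsto Y(t)$ over the comma category of morphisms from $x$ to objects of degree $\le m$. The reduced matching object $\overline M_x^m$ is the pullback of the inclusion $M_x^m\to\prod_{\mathcal J(x,t),|t|\le m}Y(t)$ along the section $\prod_{\widetilde{\mathbf J}(x,t),|t|\le m}Y(t)\to\prod_{\mathcal J(x,t),|t|\le m}Y(t)$ that is zero on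 the null factors; it comes with an inclusion $\overline M_x^m\hookrightarrow\prod_{\widetilde{\mathbf J}(x,t),|t|\le m}Y(t)$. Assume $Y$ is *pointed Reedy fibrant*: each canonical map $Y(s)\to\overline M_s^{|s|-1}$ is a fibration. For $|x|>k\ge 2$, let $\overline\Psi:\prod_{\widetilde{\mathbf J}(x,t),|t|<k}Y(t)\to\prod_{\widetilde{\mathbf J}(x,s),|s|=k}\prod_{\widetilde{\mathbf J}(s,v),|v|<k}Y(v)$ be the generalized diagonal, whose component at $x\to s\to v$ is the projection to the factor of the composite $x\to v$ if this is non-null, and zero otherwise. Let $\overline Q_x^{k-1}$ be the pullback of $\overline\Psi$ and $\prod_s\overline M_s^{k-1}\hookrightarrow\prod_s\prod_vY(v)$ (products indexed as above), and $\overline P_x^k$ the pullback of $\overline Q_x^{k-1}\to\prod_s\overline M_s^{k-1}\leftarrow\prod_sY(s)$; there is a canonical map $\overline M_x^k\to\overline P_x^k$. **Separation grids** (for $\mathcal J$ fully reduced) are defined by induction on $k\ge2$. A separation grid for $(x,k)$, where $2\le k\le n$ and $|x|>k$, has objects $F_{x,k}^{j,i}$ for $0\le j\le k-1$ and $\max(j,1)\le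 i\le k+1$, with horizontal maps $F_{x,k}^{j+1,i}\to F_{x,k}^{j,i}$ and vertical maps $F_{x,k}^{j,i+1}\to F_{x,k}^{j,i}$, all squares being pullbacks. Its column $j=0$, from top to bottom, consists of $F_{x,k}^{0,k+1}=\prod_sY(s)$, $F_{x,k}^{0,k}=\prod_s\overline M_s^{k-1}$, $F_{x,k}^{0,r+1}=\prod_sF_{s,k-1}^{r,k}$ for $k-2\ge r\ge1$, and $F_{x,k}^{0,1}=\prod_s\prod_{\widetilde{\mathbf J}(s,v),|v|<k}Y(v)$, where $s$ runs over the targets of the maps in $\widetilde{\mathbf J}(x,s)$ with $|s|=k$. The vertical maps in this column are products of the maps $Y(s)\to\overline M_s^{k-1}$ and of the tower $\overline M_s^{k-1}\to F_{s,k-1}^{k-2,k}\to\dots\to F_{s,k-1}^{1,k}\to F_{s,k-1}^{0,k}=\prod_{|v|=k-1}Y(v)=\prod_{|v|<k}Y(v)$ obtained from the top row of a separation grid chosen for $(s,k-1)$, precomposed with $\overline M_s^{k-1}\to\overline P_s^{k-1}$ (for $k=2$ there is only the inclusion $\overline M_s^1\hookrightarrow\prod_{|v|<2}Y(v)$). The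 map $\overline\Psi$ is factored as a weak equivalence to $F_{x,k}^{1,1}$ followed by a fibration $F_{x,k}^{1,1}\to F_{x,k}^{0,1}$, and for $1\le j\le k-2$ the induced map $\overline Q_x^{k-1}\to F_{x,k}^{j,j+1}$ is factored as a weak equivalence to $F_{x,k}^{j+1,j+1}$ followed by a fibration; $\overline P_x^k$ maps compatibly to the top row. All choices of factorizations are arbitrary. **Lemma.** Let $\mathcal J$ be a fully reduced pointed indexing category, $n\ge k\ge j\ge2$, $\mathcal E_*$ and $Y:\mathcal J_n\to\mathcal E_*$ as above with $Y$ pointed Reedy fibrant, and $x$ an object of $\mathcal J$ with $|x|>n$. Then for every separation grid for $(x,k)$ there is a weak equivalence (a zigzag of weak equivalences) $$F_{x,k}^{j-1,j}\;\simeq\;\prod_{(f_{k-j},\dots,f_k)}\Omega^{j-1}Y(v),$$ where the product is over all strings of $j+1$ composable non-identity maps $f_k,f_{k-1},\dots,f_{k-j}$ in $\widetilde{\mathbf J}$ such that $f_k$ has source $x$, each $f_i$ has target of degree $i$, and $v$ is the target of $f_{k-j}$. Here $\Omega Z$ is the fibre of $PZ\to Z$, for a factorization $0\to PZ\to Z$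 of the zero map as a trivial cofibration followed by a fibration. -/

import Mathlib

open CategoryTheory CategoryTheory.Limits HomotopicalAlgebra

universe w v u

/-- A pointed indexing category: a small, locally finite, connected (Reedy) category with a degree
function such that every non-identity morphism strictly lowers the degree, every degree has finitely
many objects and every object maps to one of degree zero, together with a two-sided ideal `null` of
morphisms.  The complement of `null` consists of the non-null morphisms.  (Since all non-identity
morphisms lower degree, the Reedy factorization axiom is automatic.) -/
class PointedIndexingCategory (J : Type w) [SmallCategory J] where
  deg : J → ℕ
  connected : IsConnected J
  finite_hom : ∀ a b : J, Finite (a ⟶ b)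
  finite_deg : ∀ d : ℕ, {a : J | deg a = d}.Finite
  id_or_deg_lt : ∀ {a b : J} (f : a ⟶ b), (∃ h : a = b, f = eqToHom h) ∨ deg b < deg a
  exists_hom_deg_zero : ∀ a : J, ∃ b : J, deg b = 0 ∧ Nonempty (a ⟶ b)
  null : MorphismProperty J
  null_id_iff : ∀ a : J, null (𝟙 a) ↔ IsZero a
  null_comp_left : ∀ {a b c : J} (f : a ⟶ b) (g : b ⟶ c), null f → null (f ≫ g)
  null_comp_right : ∀ {a b c : J} (f : a ⟶ b) (g : b ⟶ c), null g → null (f ≫ g)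

open PointedIndexingCategory

open scoped ZeroObject

/-- Every morphism lowering the degree by at least two is null. -/
class FullyReduced (J : Type w) [SmallCategory J] [PointedIndexingCategory J] : Prop where
  null_of_deg : ∀ {a b : J} (f : a ⟶ b), deg b + 2 ≤ deg a → null f

noncomputable section

section Indexing

variable (J : Type w) [SmallCategory J] [PointedIndexingCategory J]

/-- The full subcategory of the objects of degree at most `n`. -/
abbrev TruncCat (n : ℕ) : Type w :=
  ObjectProperty.FullSubcategory (fun t : J => deg t ≤ n)

variable {J} {n : ℕ}

/-- All morphisms out of `x` to the objects `t` (of degree at most `n`) whose degree satisfies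
`P`. -/
structure Arr (n : ℕ) (x : J) (P : ℕ → Prop) where
  tgt : TruncCat J n
  prop : P (deg tgt.obj)
  hom : x ⟶ tgt.obj

/-- The non-null morphisms out of `x` to the objects `t` (of degree at most `n`) whose degree
satisfies `P`. -/
structure NonNull (n : ℕ) (x : J) (P : ℕ → Prop) extends Arr n x P where
  nonnull : ¬ null hom

/-- The same morphism, with a weaker condition on the degree of the target. -/
abbrev NonNull.weaken {x : J} {P Q : ℕ → Prop} (f : NonNull n x P) (h : ∀ d, P d → Q d) :
    NonNull n x Q where
  tgt := f.tgt
  prop := h _ f.prop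
  hom := f.hom
  nonnull := f.nonnull

instance (a b : J) : Finite (a ⟶ b) := finite_hom a b

instance finite_trunc : Finite (TruncCat J n) := by
  have h : {a : J | deg a ≤ n}.Finite := by
    have : {a : J | deg a ≤ n} = ⋃ d ∈ Set.Iic n, {a : J | deg a = d} := by
      ext a; simp
    rw [this]
    exact (Set.finite_Iic n).biUnion fun d _ => finite_deg d
  have := h.to_subtype
  exact Finite.of_injective (fun t : TruncCat J n => (⟨t.obj, t.property⟩ : {a : J | deg a ≤ n}))
    (fun s t hst => by
      cases s; cases t
      simpa using hst)

instance (x : J) (P : ℕ → Prop) : Finite (Arr n x P) :=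
  Finite.of_injective (β := Σ t : TruncCat J n, x ⟶ t.obj) (fun f => ⟨f.tgt, f.hom⟩)
    (fun f g h => by
      cases f; cases g
      simpa using h)

instance (x : J) (P : ℕ → Prop) : Finite (NonNull n x P) :=
  Finite.of_injective NonNull.toArr (fun f g h => by
    cases f; cases g
    simpa using h)

/-- In a fully reduced category a non-null morphism `s ⟶ v` with `deg v < deg s = k + 1` has a
target of degree exactly `k`. -/
def NonNull.ofLT [FullyReduced J] {x : J} {k : ℕ} (hx : deg x = k + 1)
    (f : NonNull n x (· < k + 1)) : NonNull n x (· = k) where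
  tgt := f.tgt
  prop := by
    by_contra h
    have h1 : deg f.tgt.obj < k + 1 := f.prop
    exact f.nonnull (FullyReduced.null_of_deg f.hom (by change ¬ deg f.tgt.obj = k at h; omega))
  hom := f.hom
  nonnull := f.nonnull

/-- `NonNullString n l k x`: strings of `l + 1` composable non-null morphisms starting at `x`, with
targets of degrees `k, k - 1, …, k - l`.  When `deg x > k` no morphism of such a string is an
identity. -/
def NonNullString (n : ℕ) : ℕ → ℕ → J → Type w
  | 0, k, x => NonNull n x (· = k)
  | _ + 1, 0, _ => PEmpty
  | l + 1, k + 1, x => Σ f : NonNull n x (· = k + 1), NonNullString n l k f.tgt.obj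

/-- The last target of a string. -/
def NonNullString.target : ∀ {l k : ℕ} {x : J}, NonNullString n l k x → TruncCat J n
  | 0, _, _, f => (f : NonNull n _ _).tgt
  | _ + 1, 0, _, σ => PEmpty.elim σ
  | l + 1, k + 1, _, σ => NonNullString.target (l := l) (k := k) σ.2

instance finite_nonNullString (l k : ℕ) (x : J) : Finite (NonNullString n l k x) := by
  induction l generalizing k x with
  | zero => exact inferInstanceAs (Finite (NonNull n x (· = k)))
  | succ l ih =>
    cases k with
    | zero => exact inferInstanceAs (Finite PEmpty)
    | succ k =>
      exact inferInstanceAs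
        (Finite (Σ f : NonNull n x (· = k + 1), NonNullString n l k f.tgt.obj))

/-- The comma category under `x`: its objects are the morphisms from `x` to objects whose degree
satisfies `P` (and is at most `n`), its morphisms are commutative triangles under `x`. -/
instance (x : J) (P : ℕ → Prop) : SmallCategory (Arr n x P) where
  Hom f g := {h : f.tgt ⟶ g.tgt // f.hom ≫ h.hom = g.hom}
  id f := ⟨𝟙 _, by simp⟩
  comp h h' := ⟨h.1 ≫ h'.1, by
    rw [ObjectProperty.FullSubcategory.comp_hom, ← Category.assoc, h.2, h'.2]⟩

variable (J) in
/-- The functor sending `x ⟶ t` to `t`. -/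
def Arr.proj (x : J) (P : ℕ → Prop) : Arr n x P ⥤ TruncCat J n where
  obj f := f.tgt
  map h := h.1

instance (s t : TruncCat J n) : Finite (s ⟶ t) :=
  Finite.of_injective (β := (s.obj ⟶ t.obj)) (fun h => h.hom)
    (fun _ _ e => ObjectProperty.hom_ext _ e)

instance (x : J) (P : ℕ → Prop) (f g : Arr n x P) : Finite (f ⟶ g) :=
  inferInstanceAs (Finite {h : f.tgt ⟶ g.tgt // f.hom ≫ h.hom = g.hom})

instance (x : J) (P : ℕ → Prop) : FinCategory (Arr n x P) where
  fintypeObj := Fintype.ofFinite _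
  fintypeHom _ _ := Fintype.ofFinite _

end Indexing

section ModelCategoryNotions

variable {C : Type u} [Category.{v} C]

/-- Two objects are weakly equivalent if a zigzag of weak equivalences connects them. -/
def WeaklyEquivalent [CategoryWithWeakEquivalences C] (X Y : C) : Prop :=
  Relation.EqvGen (fun A B : C => ∃ f : A ⟶ B, WeakEquivalence f) X Y

variable [ModelCategory C] [HasZeroObject C] [HasZeroMorphisms C]

/-- A reduced path object with its path fibration `P Z ⟶ Z`: the factorization of `0 ⟶ Z` as a
trivial cofibration followed by a fibration. -/
def pathFactorization (Z : C) :
    (trivialCofibrations C).MapFactorizationData (fibrations C) (0 : (0 : C) ⟶ Z) :=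
  MorphismProperty.factorizationData _ _ _

/-- The loop object `Ω Z` (of a fibrant object `Z`): the fibre of the path fibration. -/
def loopObj (Z : C) : C := kernel (pathFactorization Z).p

end ModelCategoryNotions

section Diagrams

variable (J : Type w) [SmallCategory J] [PointedIndexingCategory J] (n : ℕ)
  (C : Type u) [Category.{v} C]

/-- A pointed diagram on the objects of degree at most `n`: a functor that sends null morphisms to
zero morphisms. -/
structure PointedDiagram [HasZeroMorphisms C] extends TruncCat J n ⥤ C where
  map_null : ∀ {s t : TruncCat J n} (f : s ⟶ t), null f.hom → map f = 0

variable {J n C}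

namespace PointedDiagram

section Matching

variable [ModelCategory C] [HasZeroMorphisms C] (Y : PointedDiagram J n C)

/-- The product of the `Y t` over all morphisms `x ⟶ t` whose target has degree satisfying `P`. -/
abbrev prodAll (x : J) (P : ℕ → Prop) : C := ∏ᶜ fun f : Arr n x P => Y.obj f.tgt

/-- The product of the `Y t` over the non-null morphisms `x ⟶ t` whose target has degree
satisfying `P`. -/
abbrev prodNonNull (x : J) (P : ℕ → Prop) : C := ∏ᶜ fun f : NonNull n x P => Y.obj f.tgt

/-- The matching object: the limit of `(x ⟶ t) ↦ Y t` over the comma category of morphisms to objects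
of degree `< m`.  In the usual notation it is `M_x^{m - 1}`. -/
abbrev matching (x : J) (m : ℕ) : C := limit (Arr.proj J x (· < m) ⋙ Y.toFunctor)

/-- The coordinate of the matching object at a morphism. -/
def matchingProj {x : J} {m : ℕ} (f : Arr n x (· < m)) : Y.matching x m ⟶ Y.obj f.tgt :=
  limit.π (Arr.proj J x (· < m) ⋙ Y.toFunctor) f

/-- The inclusion of the matching object into the product. -/
def forget (x : J) (m : ℕ) : Y.matching x m ⟶ Y.prodAll x (· < m) :=
  Pi.lift fun f => Y.matchingProj f

open Classical in
/-- The projection of the product over non-null morphisms to the factor of `f` if `f` is non-null,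
and the zero map if `f` is null. -/
def proj {x : J} {P : ℕ → Prop} (f : Arr n x P) : Y.prodNonNull x P ⟶ Y.obj f.tgt :=
  if h : null f.hom then 0
  else Pi.π (fun f : NonNull n x P => Y.obj f.tgt) { f with nonnull := h }

lemma proj_of_null {x : J} {P : ℕ → Prop} (f : Arr n x P) (h : null f.hom) : Y.proj f = 0 :=
  dif_pos h

lemma proj_toArr {x : J} {P : ℕ → Prop} (f : NonNull n x P) :
    Y.proj f.toArr = Pi.π (fun f : NonNull n x P => Y.obj f.tgt) f :=
  dif_neg f.nonnull

/-- The section of the projection of products that is zero on the factors indexed by null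
morphisms. -/
def theta (x : J) (P : ℕ → Prop) : Y.prodNonNull x P ⟶ Y.prodAll x P :=
  Pi.lift fun f => Y.proj f

/-- The reduced matching object for the targets of degree `< m`; in the usual notation it is
`Mbar_x^{m - 1}`. -/
abbrev redMatching (x : J) (m : ℕ) : C :=
  pullback (Y.theta x (· < m)) (Y.forget x m)

/-- The inclusion of the reduced matching object into the product over non-null morphisms. -/
def redForget (x : J) (m : ℕ) : Y.redMatching x m ⟶ Y.prodNonNull x (· < m) :=
  pullback.fst _ _

lemma redForget_proj {x : J} {m : ℕ} (f : Arr n x (· < m)) :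
    Y.redForget x m ≫ Y.proj f =
      pullback.snd (Y.theta x (· < m)) (Y.forget x m) ≫ Y.matchingProj f := by
  have h := (pullback.condition (f := Y.theta x (· < m)) (g := Y.forget x m)) =≫
    Pi.π (fun f : Arr n x (· < m) => Y.obj f.tgt) f
  rw [Category.assoc, Category.assoc, theta, forget, Pi.lift_π, Pi.lift_π] at h
  exact h

lemma matchingProj_map {x : J} {m : ℕ} (g f : Arr n x (· < m)) (h : g.tgt ⟶ f.tgt)
    (w : g.hom ≫ h.hom = f.hom) : Y.matchingProj g ≫ Y.map h = Y.matchingProj f :=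
  limit.w (Arr.proj J x (· < m) ⋙ Y.toFunctor) (⟨h, w⟩ : g ⟶ f)

lemma redForget_proj_map {x : J} {m : ℕ} (g f : Arr n x (· < m)) (h : g.tgt ⟶ f.tgt)
    (w : g.hom ≫ h.hom = f.hom) :
    (Y.redForget x m ≫ Y.proj g) ≫ Y.map h = Y.redForget x m ≫ Y.proj f := by
  rw [redForget_proj, redForget_proj, Category.assoc, Y.matchingProj_map g f h w]

/-- The value of `Y` on a morphism of `J`. -/
abbrev arrMap {s : TruncCat J n} {P : ℕ → Prop} (f : Arr n s.obj P) : Y.obj s ⟶ Y.obj f.tgt :=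
  Y.map (ObjectProperty.homMk f.hom)

/-- The map from `Y s` to the limit that is its matching object. -/
def toMatching (s : TruncCat J n) (m : ℕ) : Y.obj s ⟶ Y.matching s.obj m :=
  limit.lift (Arr.proj J s.obj (· < m) ⋙ Y.toFunctor)
    { pt := Y.obj s
      π :=
        { app := fun f => Y.arrMap f
          naturality := fun f g h => by
            have e : (ObjectProperty.homMk g.hom : s ⟶ g.tgt) =
                ObjectProperty.homMk f.hom ≫ h.1 :=
              ObjectProperty.hom_ext _ h.2.symm
            exact (Category.id_comp _).trans ((congrArg Y.map e).trans (Y.map_comp _ _)) } }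

lemma toMatching_proj (s : TruncCat J n) {m : ℕ} (f : Arr n s.obj (· < m)) :
    Y.toMatching s m ≫ Y.matchingProj f = Y.arrMap f :=
  limit.lift_π _ _

lemma lift_proj (s : TruncCat J n) {P : ℕ → Prop} (f : Arr n s.obj P) :
    Pi.lift (fun f : NonNull n s.obj P => Y.arrMap f.toArr) ≫ Y.proj f = Y.arrMap f := by
  by_cases h : null f.hom
  · rw [proj_of_null _ _ h, comp_zero]
    exact (Y.map_null _ h).symm
  · rw [show f = ({ f with nonnull := h } : NonNull n s.obj P).toArr from rfl, proj_toArr,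
      Pi.lift_π]

/-- The map from `Y s` to its reduced matching object (for targets of degree `< m`). -/
def matchingMap (s : TruncCat J n) (m : ℕ) : Y.obj s ⟶ Y.redMatching s.obj m :=
  pullback.lift (Pi.lift fun f => Y.arrMap f.toArr) (Y.toMatching s m) (by
    apply Pi.hom_ext
    intro f
    rw [Category.assoc, Category.assoc, theta, forget, Pi.lift_π, Pi.lift_π, lift_proj,
      toMatching_proj])

lemma matchingMap_proj (s : TruncCat J n) {m : ℕ} (f : Arr n s.obj (· < m)) :
    Y.matchingMap s m ≫ Y.redForget s.obj m ≫ Y.proj f = Y.arrMap f := by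
  rw [matchingMap, redForget, pullback.lift_fst_assoc, lift_proj]

/-- Pointed Reedy fibrancy: the map from each `Y s` to its reduced matching object of all targets of
lower degree is a fibration.  (For `deg s = 0` this says that `Y s` is fibrant.) -/
def IsReedyFibrant : Prop :=
  ∀ s : TruncCat J n, Fibration (Y.matchingMap s (deg s.obj))

end Matching

section LowerPieces

variable [ModelCategory C] [HasZeroMorphisms C] (Y : PointedDiagram J n C) (x : J) (k : ℕ)

/-- `∏_{x ⟶ s, deg s = k} ∏_{s ⟶ v, deg v < k} Y v`, over non-null morphisms. -/
abbrev prodProd : C := ∏ᶜ fun g : NonNull n x (· = k) => Y.prodNonNull g.tgt.obj (· < k)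

/-- `∏_{x ⟶ s, deg s = k} Mbar_s^{k-1}`, over non-null morphisms. -/
abbrev prodMatching : C := ∏ᶜ fun g : NonNull n x (· = k) => Y.redMatching g.tgt.obj k

/-- The composite of `g : x ⟶ s` and `f : s ⟶ v`. -/
abbrev comp {x : J} {P Q : ℕ → Prop} (g : Arr n x P) (f : Arr n g.tgt.obj Q) : Arr n x Q where
  tgt := f.tgt
  prop := f.prop
  hom := g.hom ≫ f.hom

/-- The generalized diagonal: at `x ⟶ s ⟶ v` it is the coordinate at the composite if this is
non-null, and zero otherwise. -/
def genDiag : Y.prodNonNull x (· < k) ⟶ Y.prodProd x k :=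
  Pi.lift fun g => Pi.lift fun f => Y.proj (comp g.toArr f.toArr)

/-- The pullback `Qbar_x^{k-1}` of the generalized diagonal along the product of the inclusions. -/
abbrev Q : C :=
  pullback (Y.genDiag x k)
    (Limits.Pi.map (fun g : NonNull n x (· = k) => Y.redForget g.tgt.obj k))

/-- The map from `Qbar` to the reduced matching object at a non-null `x ⟶ s` with `deg s = k`. -/
def QProj (g : NonNull n x (· = k)) : Y.Q x k ⟶ Y.redMatching g.tgt.obj k :=
  pullback.snd _ _ ≫ Pi.π (fun g : NonNull n x (· = k) => Y.redMatching g.tgt.obj k) g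

/-- The pullback `Pbar_x^k` of `Qbar ⟶ ∏ Mbar_s^{k-1} ⟵ ∏ Y s`. -/
abbrev P : C :=
  pullback (pullback.snd _ _ : Y.Q x k ⟶ Y.prodMatching x k)
    (Limits.Pi.map (fun g : NonNull n x (· = k) => Y.matchingMap g.tgt k))

def PToQ : Y.P x k ⟶ Y.Q x k := pullback.fst _ _

def PProj (g : NonNull n x (· = k)) : Y.P x k ⟶ Y.obj g.tgt :=
  pullback.snd _ _ ≫ Pi.π (fun g : NonNull n x (· = k) => Y.obj g.tgt) g

/-- The coordinate of the reduced matching object at a non-null morphism. -/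
def redProj {x : J} {m : ℕ} (f : NonNull n x (· < m)) : Y.redMatching x m ⟶ Y.obj f.tgt :=
  Y.redForget x m ≫ Y.proj f.toArr

/-- The canonical map `Mbar_x^k ⟶ Qbar_x^{k-1}`. -/
def redMatchingToQ : Y.redMatching x (k + 1) ⟶ Y.Q x k :=
  pullback.lift
    (Pi.lift fun f => Y.redProj (f.weaken fun _ h => Nat.lt_succ_of_lt h))
    (Pi.lift fun g =>
      Y.redProj (g.weaken fun _ h => Nat.lt_succ_of_le (Nat.le_of_eq h)) ≫ Y.matchingMap g.tgt k)
    (by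
      apply Pi.hom_ext
      intro g
      apply Pi.hom_ext
      intro f
      have e : Y.redForget g.tgt.obj k ≫
          Pi.π (fun f : NonNull n g.tgt.obj (· < k) => Y.obj f.tgt) f =
          Y.redForget g.tgt.obj k ≫ Y.proj f.toArr := by rw [proj_toArr]
      have e2 := Y.redForget_proj_map (x := x) (m := k + 1)
        (g.weaken fun _ h => Nat.lt_succ_of_le (Nat.le_of_eq h)).toArr
        ⟨f.tgt, Nat.lt_succ_of_lt f.prop, g.hom ≫ f.hom⟩ (ObjectProperty.homMk f.hom) rfl
      rw [Category.assoc, Category.assoc, Category.assoc, Category.assoc, genDiag,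
        Pi.lift_π_assoc, Pi.lift_π, Limits.Pi.map_π_assoc, Pi.lift_π_assoc, Category.assoc, e, matchingMap_proj]
      refine Eq.trans ?_ e2.symm
      by_cases h : null (g.hom ≫ f.hom)
      · rw [proj_of_null _ _ h, proj_of_null _ _ h, comp_zero, comp_zero]
      · let fg : NonNull n x (· < k) :=
          { tgt := f.tgt, prop := f.prop, hom := g.hom ≫ f.hom, nonnull := h }
        exact (congrArg (_ ≫ ·) (Y.proj_toArr fg)).trans (Pi.lift_π _ fg))

/-- The canonical map `Mbar_x^k ⟶ Pbar_x^k`. -/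
def redMatchingToP : Y.redMatching x (k + 1) ⟶ Y.P x k :=
  pullback.lift (Y.redMatchingToQ x k)
    (Pi.lift fun g => Y.redProj (g.weaken fun _ h => Nat.lt_succ_of_le (Nat.le_of_eq h)))
    (by
      apply Pi.hom_ext
      intro g
      rw [redMatchingToQ, pullback.lift_snd, Category.assoc, Limits.Pi.map_π, Pi.lift_π,
        Pi.lift_π_assoc])

end LowerPieces

end PointedDiagram

section Grids

variable [ModelCategory C] [HasZeroMorphisms C] (Y : PointedDiagram J n C)

/-- The data of a factorization
`Mbar_s^{k-1} ⟶ obj (k-2) ⟶ … ⟶ obj 1 ⟶ obj 0` of the inclusion of the reduced matching object of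
`s` (where `deg s = k ≥ 2`) into the product over the non-null `s ⟶ v` with `deg v < k`; `legs` are
the product projections of `obj 0`, and `top r` is the map `Mbar_s^{k-1} ⟶ obj r`.  Only the values
`r ≤ k - 2` matter.  Which of these data are used is prescribed by `IsSeparationTower`. -/
structure SeparationTower (s : TruncCat J n) (k : ℕ) where
  obj : ℕ → C
  map : ∀ r, obj (r + 1) ⟶ obj r
  top : ∀ r, Y.redMatching s.obj k ⟶ obj r
  legs : ∀ f : NonNull n s.obj (· < k), obj 0 ⟶ Y.obj f.tgt

/-- A separation grid for `x` at stage `k ≥ 2`, given towers for the objects `s` of degree `k`.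
The object `F j i` is `F_{x,k}^{j,i}` for `0 ≤ j ≤ k - 1`, `max j 1 ≤ i ≤ k + 1`; other values of the
indices do not matter.  Column `0` consists, from the top, of
`F 0 (k+1) = ∏_s Y s`, `F 0 k = ∏_s Mbar_s^{k-1}`, `F 0 (r+1) = ∏_s (T s).obj r` for `1 ≤ r ≤ k - 2`
and `F 0 1 = ∏_s ∏_{s ⟶ v, deg v < k} Y v`, with products over the non-null maps `x ⟶ s`,
`deg s = k`, and with the evident vertical maps. -/
structure SeparationGrid (x : J) (k : ℕ)
    (T : ∀ s : TruncCat J n, deg s.obj = k → SeparationTower Y s k) where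
  F : ℕ → ℕ → C
  /-- horizontal maps -/
  hor : ∀ j i, F (j + 1) i ⟶ F j i
  /-- vertical maps -/
  ver : ∀ j i, F j (i + 1) ⟶ F j i
  /-- all squares of the grid are pullbacks -/
  isPullback : ∀ j i, j + 2 ≤ k → j + 1 ≤ i → i ≤ k →
    IsPullback (hor j (i + 1)) (ver (j + 1) i) (ver j i) (hor j i)
  /-- projections of the objects of column `0` -/
  projY : ∀ g : NonNull n x (· = k), F 0 (k + 1) ⟶ Y.obj g.tgt
  projM : ∀ g : NonNull n x (· = k), F 0 k ⟶ Y.redMatching g.tgt.obj k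
  projT : ∀ (g : NonNull n x (· = k)) (r : ℕ), F 0 (r + 1) ⟶ (T g.tgt g.prop).obj r
  isLimit_projY : Nonempty (IsLimit (Fan.mk (F 0 (k + 1)) projY))
  isLimit_projM : Nonempty (IsLimit (Fan.mk (F 0 k) projM))
  isLimit_projT : ∀ r, 1 ≤ r → r + 2 ≤ k →
    Nonempty (IsLimit (Fan.mk (F 0 (r + 1)) fun g => projT g r))
  isLimit_proj_one : Nonempty (IsLimit (Fan.mk (F 0 1)
    fun p : (Σ g : NonNull n x (· = k), NonNull n g.tgt.obj (· < k)) =>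
      projT p.1 0 ≫ (T p.1.tgt p.1.prop).legs p.2))
  /-- the vertical maps of column `0` -/
  ver_projM : ∀ g, ver 0 k ≫ projM g = projY g ≫ Y.matchingMap g.tgt k
  ver_projT_top : ∀ g r (h : r + 2 = k),
    ver 0 (r + 1) ≫ projT g r =
      eqToHom (by rw [← h]) ≫ projM g ≫ (T g.tgt g.prop).top r
  ver_projT : ∀ g r, r + 3 ≤ k →
    ver 0 (r + 1) ≫ projT g r = projT g (r + 1) ≫ (T g.tgt g.prop).map r
  /-- the maps from `Qbar` to the rows `i ≤ k` of the grid -/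
  q : ∀ j i, Y.Q x k ⟶ F j i
  q_hor : ∀ j i, j + 2 ≤ k → j + 1 ≤ i → i ≤ k → q (j + 1) i ≫ hor j i = q j i
  q_ver : ∀ j i, j + 1 ≤ k → j ≤ i → 1 ≤ i → i + 1 ≤ k → q j (i + 1) ≫ ver j i = q j i
  q_projM : ∀ g, q 0 k ≫ projM g = Y.QProj x k g
  q_projT : ∀ g r, r + 2 ≤ k →
    q 0 (r + 1) ≫ projT g r = Y.QProj x k g ≫ (T g.tgt g.prop).top r
  /-- the maps from `Pbar` to the top row of the grid -/
  p : ∀ j, Y.P x k ⟶ F j (k + 1)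
  p_hor : ∀ j, j + 2 ≤ k → p (j + 1) ≫ hor j (k + 1) = p j
  p_ver : ∀ j, j + 1 ≤ k → p j ≫ ver j k = Y.PToQ x k ≫ q j k
  p_projY : ∀ g, p 0 ≫ projY g = Y.PProj x k g
  /-- the generalized diagonal is factored as a weak equivalence `ι` followed by a fibration -/
  ι : Y.prodNonNull x (· < k) ⟶ F 1 1
  weakEquivalence_ι : WeakEquivalence ι
  ι_hor : ∀ g f, ι ≫ hor 0 1 ≫ projT g 0 ≫ (T g.tgt g.prop).legs f =
    Y.genDiag x k ≫ Pi.π (fun g : NonNull n x (· = k) => Y.prodNonNull g.tgt.obj (· < k)) g ≫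
      Pi.π (fun f : NonNull n g.tgt.obj (· < k) => Y.obj f.tgt) f
  q_one_one : q 1 1 = pullback.fst _ _ ≫ ι
  /-- the maps from `Qbar` to `F j (j+1)` are factored as weak equivalences to `F (j+1) (j+1)`
  followed by fibrations -/
  weakEquivalence_q : ∀ j, 2 ≤ j → j + 1 ≤ k → WeakEquivalence (q j j)
  fibration_hor : ∀ j, j + 2 ≤ k → Fibration (hor j (j + 1))

variable {Y}

/-- The factorization of the inclusion of the reduced matching object of `s` (`deg s = k + 1`)
given by the top row of a separation grid for `s` at stage `k`, precomposed with
`Mbar_s^k ⟶ Pbar_s^k`.  Since `J` is fully reduced, the factors `Y v` with `deg v < k` do not occur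
in the target of the inclusion, so that this target is `F_{s,k}^{0,k+1}`. -/
def SeparationGrid.topRow [FullyReduced J] {s : TruncCat J n} {k : ℕ} (hs : deg s.obj = k + 1)
    {T : ∀ u : TruncCat J n, deg u.obj = k → SeparationTower Y u k}
    (G : SeparationGrid Y s.obj k T) : SeparationTower Y s (k + 1) where
  obj r := G.F r (k + 1)
  map r := G.hor r (k + 1)
  top r := Y.redMatchingToP s.obj k ≫ G.p r
  legs f := G.projY (f.ofLT hs)

variable (Y)

/-- For an object of degree two the inclusion of the reduced matching object is not factored. -/
def SeparationTower.base (s : TruncCat J n) : SeparationTower Y s 2 where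
  obj _ := Y.prodNonNull s.obj (· < 2)
  map _ := 𝟙 _
  top _ := Y.redForget s.obj 2
  legs f := Pi.π (fun f : NonNull n s.obj (· < 2) => Y.obj f.tgt) f

/-- The towers that arise inductively from (arbitrarily chosen) separation grids. -/
inductive IsSeparationTower [FullyReduced J] :
    ∀ (k : ℕ) (s : TruncCat J n), SeparationTower Y s k → Prop
  | base (s : TruncCat J n) (hs : deg s.obj = 2) :
      IsSeparationTower 2 s (SeparationTower.base Y s)
  | step (k : ℕ) (hk : 2 ≤ k) (s : TruncCat J n) (hs : deg s.obj = k + 1)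
      (T : ∀ u : TruncCat J n, deg u.obj = k → SeparationTower Y u k)
      (hT : ∀ u hu, IsSeparationTower k u (T u hu))
      (G : SeparationGrid Y s.obj k T) :
      IsSeparationTower (k + 1) s (G.topRow hs)

end Grids

end Diagrams

end

/-! The key is a vanishing. As `deg x > k` and `J` is fully reduced, no non-null map leads from `x`
to degree `< k`, so both the source of the generalized diagonal and `Q x k` are zero objects. The
diagonal entries `F j j` with `1 ≤ j < k` are weakly equivalent to one of them, hence contractible
(`isContractible_diag`). Since squares are pullbacks and rows consist of fibrations, `F j (j + 1)`
is the pullback of the column-zero map `ver 0 j : F 0 (j + 1) ⟶ F 0 j` along a fibration with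
contractible source.

This pullback is a loop object `Ω B`, where `B` is, up to equivalence, the product over non-null `x
⟶ s` of the analogous entries `F_{s,k-1}^{j-1,j}`. If `j < k - 1`, the map `ver 0 j` is a product of
top-row maps of grids for the `s`, so it is pulled back from the product of the maps
`F_{s,k-1}^{j,j} ⟶ F_{s,k-1}^{j-1,j}`, which is a fibration with contractible source. If `j = k -
1`, the map `ver 0 j` starts at the product of the reduced matching objects; full reducedness makes
these kernels (`isKernelInclusion_redProjEq`), and `ver 0 j` is the fibre inclusion of a fibration
onto `B`. For `k = 2`, where there is no grid below, `B` is computed directly. Each induction step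
thus adds one `Ω` and one arrow to the strings; the start `F 0 1` is a product over strings of two
arrows.

No properness is assumed, and arbitrary zigzags need not be compatible with products and fibres. The
induction therefore carries the stronger relation `TrivialFibrationSpan`, which is transitive and
stable under finite products and, by `TrivialFibrationSpan.loopObj`, under loop objects. -/

noncomputable section

/-! ### Spans of trivial fibrations -/

section ModelCategoryLemmas

variable {C : Type u} [Category.{v} C] [ModelCategory C]

/-- Two objects receive trivial fibrations from a common object. -/
def TrivialFibrationSpan (X Y : C) : Prop :=
  ∃ (G : C) (a : G ⟶ X) (b : G ⟶ Y), trivialFibrations C a ∧ trivialFibrations C b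

lemma trivialFibrations_of_iso {X Y : C} (e : X ≅ Y) : trivialFibrations C e.hom :=
  mem_trivialFibrations _

namespace TrivialFibrationSpan

lemma of_trivialFibration {X Y : C} {f : X ⟶ Y} (h : trivialFibrations C f) :
    TrivialFibrationSpan X Y :=
  ⟨X, 𝟙 X, f, trivialFibrations_of_iso (Iso.refl X), h⟩

lemma of_iso {X Y : C} (e : X ≅ Y) : TrivialFibrationSpan X Y :=
  of_trivialFibration (trivialFibrations_of_iso e)

lemma symm {X Y : C} (h : TrivialFibrationSpan X Y) : TrivialFibrationSpan Y X := by
  obtain ⟨G, a, b, ha, hb⟩ := h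
  exact ⟨G, b, a, hb, ha⟩

lemma trans {X Y Z : C} (h : TrivialFibrationSpan X Y) (h' : TrivialFibrationSpan Y Z) :
    TrivialFibrationSpan X Z := by
  obtain ⟨G, a, b, ha, hb⟩ := h
  obtain ⟨G', a', b', ha', hb'⟩ := h'
  exact ⟨pullback b a', pullback.fst _ _ ≫ a, pullback.snd _ _ ≫ b',
    (trivialFibrations C).comp_mem _ _
      (MorphismProperty.of_isPullback (IsPullback.of_hasPullback b a').flip ha') ha,
    (trivialFibrations C).comp_mem _ _
      (MorphismProperty.of_isPullback (IsPullback.of_hasPullback b a') hb) hb'⟩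

lemma pi {ι : Type*} [Finite ι] {X Y : ι → C} (h : ∀ i, TrivialFibrationSpan (X i) (Y i)) :
    TrivialFibrationSpan (∏ᶜ X) (∏ᶜ Y) := by
  choose G a b ha hb using h
  have ha1 := fun i => (mem_trivialFibrations_iff (a i)).1 (ha i)
  have hb1 := fun i => (mem_trivialFibrations_iff (b i)).1 (hb i)
  have := fun i => (ha1 i).1
  have := fun i => (ha1 i).2
  have := fun i => (hb1 i).1
  have := fun i => (hb1 i).2
  exact ⟨∏ᶜ G, Limits.Pi.map a, Limits.Pi.map b, mem_trivialFibrations _, mem_trivialFibrations _⟩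

lemma weaklyEquivalent {X Y : C} (h : TrivialFibrationSpan X Y) : WeaklyEquivalent X Y := by
  obtain ⟨G, a, b, ha, hb⟩ := h
  exact ((Relation.EqvGen.rel _ _ ⟨a, ((mem_trivialFibrations_iff a).1 ha).2⟩).symm).trans _ _ _
    (Relation.EqvGen.rel _ _ ⟨b, ((mem_trivialFibrations_iff b).1 hb).2⟩)

end TrivialFibrationSpan

/-- Factoring a weak equivalence between fibrations over `B` through trivial fibrations over
`B`. -/
lemma exists_trivialFibrations_over {E₁ E₂ B : C} {p₁ : E₁ ⟶ B} {p₂ : E₂ ⟶ B} [Fibration p₁]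
    [Fibration p₂] (f : E₁ ⟶ E₂) [WeakEquivalence f] (w : f ≫ p₂ = p₁) :
    ∃ (G : C) (a : G ⟶ E₁) (b : G ⟶ E₂), trivialFibrations C a ∧ trivialFibrations C b ∧
      a ≫ p₁ = b ≫ p₂ := by
  -- Factor the graph of `f` in the fibre product. Both projections of the fibre product are base
  -- changes of `p₁` and `p₂`, hence fibrations, and two-out-of-three along `d.i` makes the
  -- composites weak equivalences.
  let d := MorphismProperty.factorizationData (trivialCofibrations C) (fibrations C)
    (pullback.lift (𝟙 E₁) f (by rw [w, Category.id_comp]) : E₁ ⟶ pullback p₁ p₂)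
  have h1 : d.i ≫ (d.p ≫ pullback.fst p₁ p₂) = 𝟙 _ := by
    rw [← Category.assoc, d.fac, pullback.lift_fst]
  have h2 : d.i ≫ (d.p ≫ pullback.snd p₁ p₂) = f := by
    rw [← Category.assoc, d.fac, pullback.lift_snd]
  have : WeakEquivalence (d.p ≫ pullback.fst p₁ p₂) := weakEquivalence_of_precomp_of_fac h1
  have : WeakEquivalence (d.p ≫ pullback.snd p₁ p₂) := weakEquivalence_of_precomp_of_fac h2
  exact ⟨d.Z, d.p ≫ pullback.fst _ _, d.p ≫ pullback.snd _ _, mem_trivialFibrations _,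
    mem_trivialFibrations _, by rw [Category.assoc, Category.assoc, pullback.condition]⟩

/-- Replaces properness: after trading `f` for two trivial fibrations over `B`, the base change of
their common source along `b` is, by pasting, a base change of each of them. -/
lemma trivialFibrationSpan_of_isPullback {E₁ E₂ B B' F₁ F₂ : C} {p₁ : E₁ ⟶ B} {p₂ : E₂ ⟶ B}
    [Fibration p₁] [Fibration p₂] (f : E₁ ⟶ E₂) [WeakEquivalence f] (w : f ≫ p₂ = p₁)
    {b : B' ⟶ B} {i₁ : F₁ ⟶ E₁} {q₁ : F₁ ⟶ B'} {i₂ : F₂ ⟶ E₂} {q₂ : F₂ ⟶ B'}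
    (h₁ : IsPullback i₁ q₁ p₁ b) (h₂ : IsPullback i₂ q₂ p₂ b) :
    TrivialFibrationSpan F₁ F₂ := by
  obtain ⟨G, a₁, a₂, ha₁, ha₂, e⟩ := exists_trivialFibrations_over f w
  have h := IsPullback.of_hasPullback (a₁ ≫ p₁) b
  have h' : IsPullback (pullback.fst (a₁ ≫ p₁) b) (pullback.snd (a₁ ≫ p₁) b) (a₂ ≫ p₂) b := by
    rwa [← e]
  exact ⟨_, _, _, MorphismProperty.of_isPullback (h.of_bot' h₁) ha₁,
    MorphismProperty.of_isPullback (h'.of_bot' h₂) ha₂⟩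

end ModelCategoryLemmas

/-! ### Kernels as pullbacks over the zero object -/

section Kernels

variable {C : Type u} [Category.{v} C] [HasZeroMorphisms C]

lemma isZero_pi {ι : Type*} (Z : ι → C) [HasProduct Z] (h : ∀ i, IsZero (Z i)) : IsZero (∏ᶜ Z) :=
  (IsZero.iff_id_eq_zero _).2 (Pi.hom_ext _ _ fun i => (h i).eq_of_tgt _ _)

variable [HasZeroObject C]

/-- `i` is a kernel of `p`. -/
def IsKernelInclusion {F E B : C} (i : F ⟶ E) (p : E ⟶ B) : Prop :=
  IsPullback i (0 : F ⟶ (0 : C)) p (0 : (0 : C) ⟶ B)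

namespace IsKernelInclusion

variable {F E B : C} {i : F ⟶ E} {p : E ⟶ B}

lemma mk (w : i ≫ p = 0)
    (h : ∀ {W : C} (f : W ⟶ E), f ≫ p = 0 → ∃ l : W ⟶ F, l ≫ i = f) (hi : Mono i) :
    IsKernelInclusion i p := by
  refine ⟨⟨by rw [w, comp_zero]⟩, ⟨PullbackCone.IsLimit.mk _
    (fun s => (h s.fst (by rw [s.condition, comp_zero])).choose)
    (fun s => (h s.fst (by rw [s.condition, comp_zero])).choose_spec)
    (fun s => (isZero_zero C).eq_of_tgt _ _) ?_⟩⟩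
  intro s m hm _
  rw [← cancel_mono i, hm]
  exact (h s.fst (by rw [s.condition, comp_zero])).choose_spec.symm

lemma zero (h : IsKernelInclusion i p) : i ≫ p = 0 := by
  rw [CommSq.w (IsPullback.toCommSq h), comp_zero]

lemma mono (h : IsKernelInclusion i p) : Mono i :=
  ⟨fun _ _ e => IsPullback.hom_ext h e ((isZero_zero C).eq_of_tgt _ _)⟩

lemma exists_lift (h : IsKernelInclusion i p) {W : C} (f : W ⟶ E) (w : f ≫ p = 0) :
    ∃ l : W ⟶ F, l ≫ i = f :=
  ⟨IsPullback.lift h f 0 (by rw [w, comp_zero]), IsPullback.lift_fst _ _ _ _⟩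

/-- The kernel of a pulled back map. -/
lemma of_isPullback {E' B' : C} {p' : E' ⟶ B'} {e : E' ⟶ E} {b : B' ⟶ B}
    (h : IsPullback e p' p b) {i' : F ⟶ E'} (hi : IsKernelInclusion (i' ≫ e) p)
    (w : i' ≫ p' = 0) : IsKernelInclusion i' p' :=
  mk w
    (fun f hf => by
      obtain ⟨l, hl⟩ := hi.exists_lift (f ≫ e) (by
        rw [Category.assoc, h.w, ← Category.assoc, hf, zero_comp])
      refine ⟨l, h.hom_ext (by rw [Category.assoc, hl]) (by rw [Category.assoc, w, hf, comp_zero])⟩)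
    (by have := hi.mono; exact mono_of_mono i' e)

end IsKernelInclusion

lemma isKernelInclusion_kernel_ι {E B : C} (p : E ⟶ B) [HasKernel p] :
    IsKernelInclusion (kernel.ι p) p :=
  .mk (kernel.condition p) (fun f hf => ⟨kernel.lift p f hf, kernel.lift_ι _ _ _⟩) inferInstance

lemma IsKernelInclusion.pi {ι : Type*} {F E B : ι → C} [HasProduct F] [HasProduct E]
    [HasProduct B] {i : ∀ a, F a ⟶ E a} {p : ∀ a, E a ⟶ B a}
    (h : ∀ a, IsKernelInclusion (i a) (p a)) :
    IsKernelInclusion (Limits.Pi.map i) (Limits.Pi.map p) := by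
  have := fun a => (h a).mono
  refine .mk ?_ ?_ inferInstance
  · apply Pi.hom_ext
    intro a
    simp [(h a).zero]
  · intro W f hf
    have hl (a : ι) : ∃ l : W ⟶ F a, l ≫ i a = f ≫ Pi.π _ a :=
      (h a).exists_lift _ (by simpa using hf =≫ Pi.π _ a)
    choose l hl using hl
    exact ⟨Pi.lift l, Pi.hom_ext _ _ fun a => by simp [hl]⟩

end Kernels

/-! ### Contractible objects, loop objects and fibres -/

section PointedModelCategoryLemmas

variable {C : Type u} [Category.{v} C] [ModelCategory C] [HasZeroObject C] [HasZeroMorphisms C]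

namespace IsKernelInclusion

variable {F E B : C} {i : F ⟶ E} {p : E ⟶ B}

lemma trivialFibrationSpan {F' E' : C} {i' : F' ⟶ E'} {p' : E' ⟶ B} (h : IsKernelInclusion i p)
    (h' : IsKernelInclusion i' p') [Fibration p] [Fibration p'] (f : E ⟶ E') [WeakEquivalence f]
    (w : f ≫ p' = p) : TrivialFibrationSpan F F' :=
  trivialFibrationSpan_of_isPullback f w h h'

end IsKernelInclusion

/-- The inclusion of the loop object as the fibre of the path fibration. -/
def loopObjι (B : C) : loopObj B ⟶ (pathFactorization B).Z := kernel.ι (pathFactorization B).p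

lemma isKernelInclusion_loopObjι (B : C) :
    IsKernelInclusion (loopObjι B) (pathFactorization B).p :=
  isKernelInclusion_kernel_ι _

/-- The map from the zero object is a weak equivalence. -/
def IsContractible (P : C) : Prop := WeakEquivalence (0 : (0 : C) ⟶ P)

lemma IsContractible.of_isZero {Z P : C} (hZ : IsZero Z) (f : Z ⟶ P) [WeakEquivalence f] :
    IsContractible P := by
  have : WeakEquivalence (((isZero_zero C).iso hZ).hom ≫ f) := inferInstance
  rwa [(isZero_zero C).eq_of_src (((isZero_zero C).iso hZ).hom ≫ f) 0] at this

lemma IsContractible.of_weakEquivalence {P P' : C} (f : P ⟶ P') [WeakEquivalence f]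
    (h : IsContractible P') : IsContractible P := by
  have : WeakEquivalence (0 : (0 : C) ⟶ P') := h
  exact weakEquivalence_of_postcomp_of_fac (zero_comp : (0 : (0 : C) ⟶ P) ≫ f = 0)

lemma IsContractible.to_isZero {Z P : C} (hZ : IsZero Z) (f : P ⟶ Z) [WeakEquivalence f] :
    IsContractible P := by
  have : IsIso (0 : (0 : C) ⟶ Z) := ⟨0, (isZero_zero C).eq_of_src _ _, hZ.eq_of_src _ _⟩
  exact .of_weakEquivalence f (P' := Z) (inferInstanceAs (WeakEquivalence (0 : (0 : C) ⟶ Z)))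

lemma IsContractible.trivialFibrations {P : C} (h : IsContractible P)
    [Fibration (0 : P ⟶ (0 : C))] : trivialFibrations C (0 : P ⟶ (0 : C)) := by
  have : WeakEquivalence (0 : (0 : C) ⟶ P) := h
  have : WeakEquivalence (0 : P ⟶ (0 : C)) :=
    weakEquivalence_of_precomp_of_fac (fg := 𝟙 (0 : C)) ((isZero_zero C).eq_of_src
      ((0 : (0 : C) ⟶ P) ≫ (0 : P ⟶ (0 : C))) (𝟙 _))
  exact mem_trivialFibrations _

/-- The fibre of any fibration from a contractible object is the loop object. -/
lemma IsContractible.trivialFibrationSpan_loopObj {F P B : C} (hP : IsContractible P) {i : F ⟶ P}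
    {p : P ⟶ B} [Fibration p] (h : IsKernelInclusion i p) :
    TrivialFibrationSpan F (loopObj B) := by
  have : WeakEquivalence (0 : (0 : C) ⟶ P) := hP
  -- The trivial cofibration into the path object lifts against `p`; the lift is an equivalence over
  -- `B`, so the two fibres can be compared.
  have sq : CommSq (0 : (0 : C) ⟶ P) (pathFactorization B).i p (pathFactorization B).p :=
    ⟨(isZero_zero C).eq_of_src _ _⟩
  have : WeakEquivalence sq.lift := weakEquivalence_of_precomp_of_fac sq.fac_left
  exact ((isKernelInclusion_loopObjι B).trivialFibrationSpan h sq.lift sq.fac_right).symm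

lemma isContractible_pathFactorization (B : C) : IsContractible (pathFactorization B).Z :=
  .of_isZero (isZero_zero C) (pathFactorization B).i

namespace TrivialFibrationSpan

/-- Pulling the path fibration of `Y` back along `f` keeps its fibre, and keeps the total object
contractible because the projection to the path object is a base change of `f`. So `loopObj Y` also
serves as a loop object of `X`. -/
lemma loopObj_of_trivialFibrations {X Y : C} {f : X ⟶ Y} (hf : trivialFibrations C f) :
    TrivialFibrationSpan (loopObj X) (loopObj Y) := by
  have := ((mem_trivialFibrations_iff f).1 hf).1
  have := ((mem_trivialFibrations_iff f).1 hf).2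
  have h := IsPullback.of_hasPullback (pathFactorization Y).p f
  have hc : IsContractible (pullback (pathFactorization Y).p f) :=
    (isContractible_pathFactorization Y).of_weakEquivalence (pullback.fst _ _)
  let i : loopObj Y ⟶ pullback (pathFactorization Y).p f :=
    pullback.lift (loopObjι Y) 0 (by rw [(isKernelInclusion_loopObjι Y).zero, zero_comp])
  have hi : IsKernelInclusion i (pullback.snd (pathFactorization Y).p f) := by
    refine .of_isPullback h ?_ (pullback.lift_snd _ _ _)
    have e : i ≫ pullback.fst _ _ = loopObjι Y := pullback.lift_fst _ _ _
    rw [e]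
    exact isKernelInclusion_loopObjι Y
  exact (hc.trivialFibrationSpan_loopObj hi).symm

lemma loopObj {X Y : C} (h : TrivialFibrationSpan X Y) :
    TrivialFibrationSpan (loopObj X) (loopObj Y) := by
  obtain ⟨G, a, b, ha, hb⟩ := h
  exact (loopObj_of_trivialFibrations ha).symm.trans (loopObj_of_trivialFibrations hb)

end TrivialFibrationSpan

lemma IsKernelInclusion.fibration_zero {F E B : C} {i : F ⟶ E} {p : E ⟶ B}
    (h : IsKernelInclusion i p) [Fibration p] : Fibration (0 : F ⟶ (0 : C)) := by
  rw [fibration_iff]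
  exact MorphismProperty.of_isPullback h (mem_fibrations p)

lemma fibration_zero_loopObj (B : C) : Fibration (0 : loopObj B ⟶ (0 : C)) :=
  (isKernelInclusion_loopObjι B).fibration_zero

lemma fibration_zero_of_fibration {X Y : C} (f : X ⟶ Y) [Fibration f]
    [Fibration (0 : Y ⟶ (0 : C))] : Fibration (0 : X ⟶ (0 : C)) := by
  rw [show (0 : X ⟶ (0 : C)) = f ≫ 0 from comp_zero.symm]
  infer_instance

lemma fibration_zero_pi {ι : Type*} [Finite ι] (Z : ι → C)
    (hZ : ∀ i, Fibration (0 : Z i ⟶ (0 : C))) : Fibration (0 : (∏ᶜ Z) ⟶ (0 : C)) := by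
  have : IsIso (0 : (∏ᶜ fun _ : ι => (0 : C)) ⟶ (0 : C)) :=
    ⟨0, (isZero_pi _ fun _ => isZero_zero C).eq_of_src _ _, (isZero_zero C).eq_of_src _ _⟩
  rw [(isZero_zero C).eq_of_tgt (0 : (∏ᶜ Z) ⟶ (0 : C))
    ((Limits.Pi.map fun i => (0 : Z i ⟶ (0 : C))) ≫ 0)]
  infer_instance

/-- A product of contractible fibrant objects is contractible. -/
lemma IsContractible.pi {ι : Type*} [Finite ι] {Z : ι → C} (h : ∀ i, IsContractible (Z i))
    (hZ : ∀ i, Fibration (0 : Z i ⟶ (0 : C))) : IsContractible (∏ᶜ Z) := by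
  have := fun i => ((mem_trivialFibrations_iff _).1 (h i).trivialFibrations).2
  exact .to_isZero (isZero_pi _ fun _ => isZero_zero C) (Limits.Pi.map fun i => (0 : Z i ⟶ (0 : C)))

/-- Loop objects of fibrant objects commute with products. -/
lemma trivialFibrationSpan_loopObj_pi {ι : Type*} [Finite ι] (Z : ι → C)
    (hZ : ∀ i, Fibration (0 : Z i ⟶ (0 : C))) :
    TrivialFibrationSpan (loopObj (∏ᶜ Z)) (∏ᶜ fun i => loopObj (Z i)) :=
  ((IsContractible.pi (fun i => isContractible_pathFactorization (Z i))
    (fun i => fibration_zero_of_fibration (pathFactorization (Z i)).p)).trivialFibrationSpan_loopObj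
      (.pi fun i => isKernelInclusion_loopObjι (Z i))).symm

/-- Over a contractible fibrant base the inclusion of the fibre of a fibration is an
equivalence. -/
lemma IsKernelInclusion.trivialFibrationSpan_total {F E B : C} {i : F ⟶ E} {p : E ⟶ B}
    (h : IsKernelInclusion i p) [Fibration p]
    (hB : trivialFibrations C (0 : B ⟶ (0 : C))) : TrivialFibrationSpan F E := by
  -- `d.Z` is a path object of `E`, with endpoint maps `e₀` and `e₁`. The common source will be the
  -- object of paths that start in the fibre `F`.
  let d := MorphismProperty.factorizationData (trivialCofibrations C) (fibrations C)
    (prod.lift (𝟙 E) (𝟙 E))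
  let e₀ := d.p ≫ prod.fst
  let e₁ := d.p ≫ prod.snd
  have h₀ : d.i ≫ e₀ = 𝟙 E := by rw [← Category.assoc, d.fac, prod.lift_fst]
  have h₁ : d.i ≫ e₁ = 𝟙 E := by rw [← Category.assoc, d.fac, prod.lift_snd]
  have w₀ : WeakEquivalence e₀ := weakEquivalence_of_precomp_of_fac h₀
  have w₁ : WeakEquivalence e₁ := weakEquivalence_of_precomp_of_fac h₁
  have t₀ := (mem_trivialFibrations_iff _).1 <|
    MorphismProperty.of_isPullback (IsPullback.of_hasBinaryProduct (X := E) (Y := B)).flip hB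
  have t₁ := (mem_trivialFibrations_iff _).1 <|
    MorphismProperty.of_isPullback (IsPullback.of_hasBinaryProduct (X := B) (Y := E)) hB
  have f₀ : Fibration e₀ := by
    have := t₀.1
    have e : e₀ = (d.p ≫ prod.map (𝟙 E) p) ≫ prod.fst := by simp [e₀]
    rw [e]
    infer_instance
  -- Image of the start in `B`, together with the end in `E`. It is a fibration, and an equivalence
  -- because `B ⨯ E ⟶ E` is one.
  let r : d.Z ⟶ B ⨯ E := d.p ≫ prod.map p (𝟙 E)
  have hrf : r ≫ prod.fst = e₀ ≫ p := by simp [r, e₀]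
  have hrs : r ≫ prod.snd = e₁ := by simp [r, e₁]
  have hr : trivialFibrations C r := by
    have := t₁.2
    have : WeakEquivalence r := weakEquivalence_of_postcomp_of_fac hrs
    exact mem_trivialFibrations _
  have := h.mono
  have key (s : PullbackCone (prod.lift (0 : E ⟶ B) (𝟙 E)) r) :
      ∃ l : s.pt ⟶ pullback i e₀, l ≫ pullback.snd i e₀ = s.snd := by
    obtain ⟨l, hl⟩ := h.exists_lift (s.snd ≫ e₀) (by
      have := s.condition =≫ prod.fst
      rw [Category.assoc, Category.assoc, prod.lift_fst, hrf, comp_zero] at this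
      rw [Category.assoc, this])
    exact ⟨pullback.lift l s.snd hl, pullback.lift_snd _ _ _⟩
  -- Starting in the fibre means that the `B`-component of `r` vanishes, so the endpoint map on
  -- these paths is a base change of `r`.
  have sq : IsPullback (pullback.snd i e₀ ≫ e₁) (pullback.snd i e₀)
      (prod.lift (0 : E ⟶ B) (𝟙 E)) r := by
    refine ⟨⟨?_⟩, ⟨PullbackCone.IsLimit.mk _ (fun s => (key s).choose) (fun s => ?_)
      (fun s => (key s).choose_spec) (fun s m _ hm => ?_)⟩⟩
    · apply Limits.prod.hom_ext
      · rw [Category.assoc, Category.assoc _ r, prod.lift_fst, hrf, comp_zero, ← Category.assoc,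
          ← pullback.condition, Category.assoc, h.zero, comp_zero]
      · rw [Category.assoc, Category.assoc _ r, prod.lift_snd, hrs, Category.comp_id]
    · have := s.condition =≫ prod.snd
      rw [Category.assoc, Category.assoc, prod.lift_snd, hrs, Category.comp_id] at this
      rw [← Category.assoc, (key s).choose_spec, this]
    · rw [← cancel_mono (pullback.snd i e₀), hm, (key s).choose_spec]
  exact ⟨pullback i e₀, pullback.fst i e₀, pullback.snd i e₀ ≫ e₁, mem_trivialFibrations _,
    MorphismProperty.of_isPullback sq.flip hr⟩

end PointedModelCategoryLemmas

/-! ### Products presented by limit fans, and their pullbacks and kernels -/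

section Fans

variable {C : Type u} [Category.{v} C] {ι : Type*}

lemma isIso_lift_of_isLimit {Z : ι → C} [HasProduct Z] {A : C} {π : ∀ i, A ⟶ Z i}
    (h : Nonempty (IsLimit (Fan.mk A π))) : IsIso (Pi.lift π) := by
  have e : Pi.lift π = (h.some.conePointUniqueUpToIso (productIsProduct Z)).hom :=
    Pi.hom_ext _ _ fun i => by
      rw [Pi.lift_π]
      exact (h.some.conePointUniqueUpToIso_hom_comp (productIsProduct Z) ⟨i⟩).symm
  rw [e]
  infer_instance

/-- If a product over a sigma type factors through products over the fibres, the first maps of the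
factorization form a product. -/
lemma nonempty_isLimit_fan_of_sigma {κ : ι → Type*} {Z : ι → C} {W : ∀ i, κ i → C} {A : C}
    {π : ∀ i, A ⟶ Z i} {ρ : ∀ i j, Z i ⟶ W i j}
    (h : Nonempty (IsLimit (Fan.mk A fun p : Σ i, κ i => π p.1 ≫ ρ p.1 p.2)))
    (hρ : ∀ i, Nonempty (IsLimit (Fan.mk (Z i) (ρ i)))) :
    Nonempty (IsLimit (Fan.mk A π)) := by
  have key (s : Fan Z) : ∃ l : s.pt ⟶ A, ∀ i, l ≫ π i = s.proj i := by
    refine ⟨Fan.IsLimit.lift h.some fun p => s.proj p.1 ≫ ρ p.1 p.2, fun i => ?_⟩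
    refine Fan.IsLimit.hom_ext (hρ i).some _ _ fun j => ?_
    have := Fan.IsLimit.fac h.some (fun p => s.proj p.1 ≫ ρ p.1 p.2) ⟨i, j⟩
    exact (Category.assoc _ _ _).trans this
  refine ⟨Fan.IsLimit.mk _ (fun s => (key s).choose) (fun s => (key s).choose_spec) fun s m hm => ?_⟩
  refine Fan.IsLimit.hom_ext h.some _ _ fun p => ?_
  have e1 : m ≫ π p.1 = s.proj p.1 := hm p.1
  have e2 := (key s).choose_spec p.1
  change m ≫ π p.1 ≫ ρ p.1 p.2 = (key s).choose ≫ π p.1 ≫ ρ p.1 p.2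
  rw [← Category.assoc, ← Category.assoc, e1, e2]

/-- A product of pullback squares. -/
lemma isPullback_pi {A A' : C} {E E' P B : ι → C} [HasProduct P] [HasProduct B]
    {π : ∀ i, A ⟶ E i} {π' : ∀ i, A' ⟶ E' i} (hA : Nonempty (IsLimit (Fan.mk A π)))
    (hA' : Nonempty (IsLimit (Fan.mk A' π'))) {a : ∀ i, E' i ⟶ P i} {b : ∀ i, E' i ⟶ E i}
    {p : ∀ i, P i ⟶ B i} {c : ∀ i, E i ⟶ B i} (h : ∀ i, IsPullback (a i) (b i) (p i) (c i))
    {f : A' ⟶ A} (hf : ∀ i, f ≫ π i = π' i ≫ b i) :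
    IsPullback (Pi.lift fun i => π' i ≫ a i) f (Limits.Pi.map p) (Pi.lift fun i => π i ≫ c i) := by
  have key (s : PullbackCone (Limits.Pi.map p) (Pi.lift fun i => π i ≫ c i)) :
      ∃ l : s.pt ⟶ A', ∀ i, l ≫ π' i ≫ a i = s.fst ≫ Pi.π _ i ∧ l ≫ π' i ≫ b i = s.snd ≫ π i := by
    have w (i : ι) : (s.fst ≫ Pi.π _ i) ≫ p i = (s.snd ≫ π i) ≫ c i := by
      simpa using s.condition =≫ Pi.π _ i
    have hl (i : ι) : Fan.IsLimit.lift hA'.some (fun i => (h i).lift _ _ (w i)) ≫ π' i =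
        (h i).lift _ _ (w i) := Fan.IsLimit.fac hA'.some _ i
    exact ⟨Fan.IsLimit.lift hA'.some fun i => (h i).lift _ _ (w i), fun i =>
      ⟨by rw [← Category.assoc, hl, (h i).lift_fst], by rw [← Category.assoc, hl, (h i).lift_snd]⟩⟩
  refine ⟨⟨Pi.hom_ext _ _ fun i => ?_⟩, ⟨PullbackCone.IsLimit.mk _ (fun s => (key s).choose)
    (fun s => Pi.hom_ext _ _ fun i => ?_) (fun s => Fan.IsLimit.hom_ext hA.some _ _ fun i => ?_)
    (fun s m h1 h2 => Fan.IsLimit.hom_ext hA'.some _ _ fun i => (h i).hom_ext ?_ ?_)⟩⟩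
  · simp [(h i).w, reassoc_of% (hf i)]
  · rw [Category.assoc, Pi.lift_π, ((key s).choose_spec i).1]
  · change ((key s).choose ≫ f) ≫ π i = s.snd ≫ π i
    rw [Category.assoc, hf, ((key s).choose_spec i).2]
  · change (m ≫ π' i) ≫ a i = ((key s).choose ≫ π' i) ≫ a i
    rw [Category.assoc, Category.assoc, ((key s).choose_spec i).1, ← h1, Category.assoc, Pi.lift_π]
  · change (m ≫ π' i) ≫ b i = ((key s).choose ≫ π' i) ≫ b i
    rw [Category.assoc, Category.assoc, ((key s).choose_spec i).2, ← h2, Category.assoc, hf]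

variable [HasZeroMorphisms C] [HasZeroObject C]

lemma IsKernelInclusion.of_isIso {F E B E' B' : C} {i : F ⟶ E} {p : E ⟶ B} (e : E ⟶ E')
    (b : B ⟶ B') {p' : E' ⟶ B'} [IsIso e] [IsIso b] (w : e ≫ p' = p ≫ b)
    (h : IsKernelInclusion (i ≫ e) p') : IsKernelInclusion i p :=
  .of_isPullback (IsPullback.of_horiz_isIso ⟨w⟩) h (by
    rw [← cancel_mono b, Category.assoc, ← w, ← Category.assoc, h.zero, zero_comp])

/-- The kernel of a composite is pulled back from the kernel of the second map. -/
lemma IsKernelInclusion.of_isPullback_comp {X K A E B : C} {a : X ⟶ K} {b : X ⟶ E} {i : K ⟶ A}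
    {c : E ⟶ A} {p : A ⟶ B} (h : IsPullback a b i c) (hi : IsKernelInclusion i p) :
    IsKernelInclusion b (c ≫ p) := by
  refine .mk ?_ (fun g hg => ?_) ⟨fun u v e => ?_⟩
  · rw [← Category.assoc, ← h.w, Category.assoc, hi.zero, comp_zero]
  · obtain ⟨l, hl⟩ := hi.exists_lift (g ≫ c) (by rw [Category.assoc, hg])
    exact ⟨h.lift l g hl, h.lift_snd _ _ _⟩
  · have := hi.mono
    refine h.hom_ext ?_ e
    rw [← cancel_mono i, Category.assoc, Category.assoc, h.w, ← Category.assoc, e, Category.assoc]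

lemma isKernelInclusion_fan {A A' : C} {E E' B : ι → C} [HasProduct B]
    {π : ∀ i, A ⟶ E i} {π' : ∀ i, A' ⟶ E' i} (hA : Nonempty (IsLimit (Fan.mk A π)))
    (hA' : Nonempty (IsLimit (Fan.mk A' π'))) {b : ∀ i, E' i ⟶ E i}
    {c : ∀ i, E i ⟶ B i} (h : ∀ i, IsKernelInclusion (b i) (c i))
    {f : A' ⟶ A} (hf : ∀ i, f ≫ π i = π' i ≫ b i) :
    IsKernelInclusion f (Pi.lift fun i => π i ≫ c i) := by
  refine .mk (Pi.hom_ext _ _ fun i => ?_) (fun {W} g hg => ?_) ⟨fun u v e => ?_⟩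
  · simp [reassoc_of% (hf i), (h i).zero]
  · have hl (i : ι) : ∃ l : W ⟶ E' i, l ≫ b i = g ≫ π i :=
      (h i).exists_lift _ (by simpa using hg =≫ Pi.π _ i)
    choose l hl using hl
    refine ⟨Fan.IsLimit.lift hA'.some l, Fan.IsLimit.hom_ext hA.some _ _ fun i => ?_⟩
    have : Fan.IsLimit.lift hA'.some l ≫ π' i = l i := Fan.IsLimit.fac hA'.some l i
    change (Fan.IsLimit.lift hA'.some l ≫ f) ≫ π i = g ≫ π i
    rw [Category.assoc, hf, ← Category.assoc, this, hl]
  · refine Fan.IsLimit.hom_ext hA'.some _ _ fun i => ?_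
    have := (h i).mono
    change u ≫ π' i = v ≫ π' i
    rw [← cancel_mono (b i), Category.assoc, Category.assoc, ← hf, ← Category.assoc, e,
      Category.assoc]

end Fans

/-! ### Loop objects as homotopy pullbacks of contractible objects -/

section Loops

variable {C : Type u} [Category.{v} C] [ModelCategory C] [HasZeroObject C] [HasZeroMorphisms C]

lemma fibration_zero_loopObj_iterate {Z : C} [hZ : Fibration (0 : Z ⟶ (0 : C))] (m : ℕ) :
    Fibration (0 : loopObj^[m] Z ⟶ (0 : C)) := by
  cases m with
  | zero => exact hZ
  | succ m =>
    rw [Function.iterate_succ_apply']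
    exact fibration_zero_loopObj _

/-- A pullback of two contractible objects over `B`, one of them fibrant and the other fibred over
`B`, is a loop object of `B`. -/
lemma trivialFibrationSpan_loopObj_of_isPullback {X P E B : C} {a : X ⟶ P} {b : X ⟶ E} {p : P ⟶ B}
    {c : E ⟶ B} (h : IsPullback a b p c) [Fibration p] (hP : IsContractible P)
    (hE : trivialFibrations C (0 : E ⟶ (0 : C))) : TrivialFibrationSpan X (loopObj B) := by
  have : Fibration b := by
    rw [fibration_iff]
    exact MorphismProperty.of_isPullback h (mem_fibrations p)
  -- The base change `b` has the same fibre as `p`. This fibre is equivalent to `X` because `E` is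
  -- contractible and fibrant, and to `loopObj B` because `P` is contractible.
  have hi : IsKernelInclusion (h.lift (kernel.ι p) 0 (by rw [kernel.condition, zero_comp])) b := by
    refine .of_isPullback h ?_ (h.lift_snd _ _ _)
    rw [h.lift_fst]
    exact isKernelInclusion_kernel_ι p
  exact (hi.trivialFibrationSpan_total hE).symm.trans
    (hP.trivialFibrationSpan_loopObj (isKernelInclusion_kernel_ι p))

end Loops

/-! ### Reduced matching objects in the fully reduced case -/

section Reduced

variable {J : Type w} [SmallCategory J] [PointedIndexingCategory J] [FullyReduced J] {n : ℕ}

lemma isEmpty_nonNull_lt {x : J} {k : ℕ} (hx : k < deg x) : IsEmpty (NonNull n x (· < k)) :=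
  ⟨fun f => f.nonnull (FullyReduced.null_of_deg f.hom (by have : deg f.tgt.obj < k := f.prop; omega))⟩

lemma NonNull.deg_eq_of_lt {x : J} {m : ℕ} (hx : m < deg x) (f : NonNull n x (· < m + 1)) :
    deg f.tgt.obj = m := by
  by_contra h
  have h1 : deg f.tgt.obj < m + 1 := f.prop
  exact f.nonnull (FullyReduced.null_of_deg f.hom (by omega))

/-- A non-null morphism from `x` to an object of degree `< m + 1` has a target of degree `m`. -/
def nonNullEquiv {x : J} {m : ℕ} (hx : m < deg x) :
    NonNull n x (· = m) ≃ NonNull n x (· < m + 1) where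
  toFun g := g.weaken fun _ h => Nat.lt_succ_of_le (Nat.le_of_eq h)
  invFun f := { tgt := f.tgt, prop := f.deg_eq_of_lt hx, hom := f.hom, nonnull := f.nonnull }
  left_inv _ := rfl
  right_inv _ := rfl

omit [FullyReduced J] in
lemma eq_or_deg_lt {x : J} {P : ℕ → Prop} {a b : Arr n x P} (h : a.tgt ⟶ b.tgt)
    (w : a.hom ≫ h.hom = b.hom) :
    (∃ e : a = b, h = eqToHom (by rw [e])) ∨ deg b.tgt.obj < deg a.tgt.obj := by
  obtain ⟨⟨s, hs⟩, pa, ha⟩ := a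
  obtain ⟨⟨t, ht⟩, pb, hb⟩ := b
  rcases id_or_deg_lt h.hom with ⟨e, he⟩ | e
  · left
    change s = t at e
    subst e
    have h1 : h = 𝟙 _ := ObjectProperty.hom_ext _ he
    subst h1
    have : ha = hb := (Category.comp_id _).symm.trans w
    subst this
    exact ⟨rfl, rfl⟩
  · exact .inr e

namespace PointedDiagram

variable {C : Type u} [Category.{v} C] [ModelCategory C] [HasZeroMorphisms C]
  (Y : PointedDiagram J n C)

omit [FullyReduced J] in
instance (x : J) (m : ℕ) : Mono (Y.forget x m) :=
  ⟨fun f g h => limit.hom_ext fun a => by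
    have := h =≫ Pi.π (fun f : Arr n x (· < m) => Y.obj f.tgt) a
    rw [Category.assoc, Category.assoc, forget, Pi.lift_π] at this
    exact this⟩

omit [FullyReduced J] in
instance (x : J) (m : ℕ) : Mono (Y.redForget x m) :=
  inferInstanceAs (Mono (pullback.fst _ _))

omit [FullyReduced J] in
lemma redMatching_hom_ext {x : J} {m : ℕ} {W : C} {f g : W ⟶ Y.redMatching x m}
    (h : ∀ a, f ≫ Y.redProj a = g ≫ Y.redProj a) : f = g := by
  rw [← cancel_mono (Y.redForget x m)]
  refine Pi.hom_ext _ _ fun a => ?_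
  have := h a
  rw [redProj, proj_toArr] at this
  simpa using this

/-- `Q` is a subobject of an empty product, since its projection is a base change of a monomorphism.
-/
lemma isZero_Q {x : J} {k : ℕ} (hx : k < deg x) : IsZero (Y.Q x k) := by
  have := isEmpty_nonNull_lt (n := n) hx
  have hz : IsZero (Y.prodNonNull x (· < k)) := isZero_pi _ fun i => isEmptyElim i
  have : Mono (Limits.Pi.map (fun g : NonNull n x (· = k) => Y.redForget g.tgt.obj k)) :=
    inferInstance
  have : Mono (pullback.fst _ _ : Y.Q x k ⟶ Y.prodNonNull x (· < k)) := inferInstance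
  exact hz.of_mono (pullback.fst _ _ : Y.Q x k ⟶ Y.prodNonNull x (· < k))

/-- The coordinates of the reduced matching object at the morphisms lowering the degree by one. -/
def redProjEq (x : J) (m : ℕ) :
    Y.redMatching x (m + 1) ⟶ ∏ᶜ fun g : NonNull n x (· = m) => Y.obj g.tgt :=
  Pi.lift fun g => Y.redProj (g.weaken fun _ h => Nat.lt_succ_of_le (Nat.le_of_eq h))

omit [FullyReduced J] in
lemma redProjEq_π {x : J} {m : ℕ} (g : NonNull n x (· = m)) :
    Y.redProjEq x m ≫ Pi.π _ g =
      Y.redProj (g.weaken fun _ h => Nat.lt_succ_of_le (Nat.le_of_eq h)) :=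
  Pi.lift_π _ _

omit [FullyReduced J] in
lemma matchingMap_redProj (s : TruncCat J n) {m : ℕ} (f : NonNull n s.obj (· < m)) :
    Y.matchingMap s m ≫ Y.redProj f = Y.arrMap f.toArr :=
  Y.matchingMap_proj s f.toArr

variable [HasZeroObject C]

/-- In a fully reduced category the reduced matching object is a kernel. -/
lemma isKernelInclusion_redProjEq {x : J} {m : ℕ} (hx : m < deg x) :
    IsKernelInclusion (Y.redProjEq x m)
      (Limits.Pi.map fun g : NonNull n x (· = m) => Y.matchingMap g.tgt m) := by
  refine .mk ?_ (fun {W} f hf => ?_) ⟨fun u v h => ?_⟩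
  · refine Pi.hom_ext _ _ fun g => Y.redMatching_hom_ext fun a => ?_
    rw [Category.assoc, Category.assoc, Limits.Pi.map_π_assoc, ← Category.assoc, redProjEq_π,
      matchingMap_redProj, Category.assoc, zero_comp]
    have hd : deg a.tgt.obj < m := a.prop
    -- The coordinate at the composite `x ⟶ s ⟶ v` vanishes: the composite lowers degree by at least
    -- two, so it is null.
    refine (Y.redForget_proj_map (x := x) (m := m + 1)
        (g.weaken fun _ h => Nat.lt_succ_of_le (Nat.le_of_eq h)).toArr
        ⟨a.tgt, Nat.lt_succ_of_lt a.prop, g.hom ≫ a.hom⟩ (ObjectProperty.homMk a.hom) rfl).trans ?_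
    rw [proj_of_null _ _ (FullyReduced.null_of_deg _ (by change deg a.tgt.obj + 2 ≤ _; omega)),
      comp_zero]
  · have hf' (g : NonNull n x (· = m)) (a : Arr n g.tgt.obj (· < m)) :
        f ≫ Pi.π (fun g : NonNull n x (· = m) => Y.obj g.tgt) g ≫ Y.arrMap a = 0 := by
      have := (hf =≫ Pi.π _ g) =≫ (Y.redForget g.tgt.obj m ≫ Y.proj a)
      rwa [Category.assoc, Category.assoc, Limits.Pi.map_π_assoc, matchingMap_proj, zero_comp,
        zero_comp] at this
    -- Conversely, a family killed by all matching maps has to be a compatible family once it is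
    -- extended by zero to the null maps.
    let l : W ⟶ Y.prodNonNull x (· < m + 1) :=
      Pi.lift fun a => f ≫ Pi.π (fun g : NonNull n x (· = m) => Y.obj g.tgt)
        ((nonNullEquiv hx).symm a)
    have hl (a : NonNull n x (· < m + 1)) : l ≫ Y.proj a.toArr =
        f ≫ Pi.π (fun g : NonNull n x (· = m) => Y.obj g.tgt) ((nonNullEquiv hx).symm a) := by
      rw [proj_toArr, Pi.lift_π]
      rfl
    -- Only degree-lowering triangles matter. There `b` is null; if `a` is not, its target has
    -- degree `m`, and `hf'` says that its coordinate dies in lower degrees.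
    have nat (a b : Arr n x (· < m + 1)) (h : a ⟶ b) :
        l ≫ Y.proj b = (l ≫ Y.proj a) ≫ Y.map h.1 := by
      rcases eq_or_deg_lt h.1 h.2 with ⟨e, he⟩ | hlt
      · subst e
        rw [he, eqToHom_refl]
        exact ((congrArg _ (Y.map_id _)).trans (Category.comp_id _)).symm
      · have ha : deg a.tgt.obj < m + 1 := a.prop
        rw [Y.proj_of_null b (FullyReduced.null_of_deg _ (by omega)), comp_zero]
        by_cases hn : null a.hom
        · rw [Y.proj_of_null a hn, comp_zero, zero_comp]
        · have := hl { a with nonnull := hn }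
          have hd := NonNull.deg_eq_of_lt hx { a with nonnull := hn }
          have hb : deg b.tgt.obj < m := by
            change deg a.tgt.obj = m at hd
            omega
          exact ((congrArg (· ≫ Y.map h.1) this).trans
            ((Category.assoc _ _ _).trans (hf' ((nonNullEquiv hx).symm { a with nonnull := hn })
              ⟨b.tgt, hb, h.1.hom⟩))).symm
    let c : Cone (Arr.proj J x (· < m + 1) ⋙ Y.toFunctor) :=
      { pt := W
        π :=
          { app := fun a => l ≫ Y.proj a
            naturality := fun a b h => (Category.id_comp _).trans (nat a b h) } }
    refine ⟨pullback.lift l (limit.lift _ c) ?_, ?_⟩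
    · refine Pi.hom_ext _ _ fun a => ?_
      rw [Category.assoc, Category.assoc, theta, forget, Pi.lift_π, Pi.lift_π]
      exact (limit.lift_π c a).symm
    · refine Pi.hom_ext _ _ fun g => ?_
      rw [Category.assoc, redProjEq_π, redProj, redForget, pullback.lift_fst_assoc, hl]
      rfl
  · refine Y.redMatching_hom_ext fun a => ?_
    have := h =≫ Pi.π _ ((nonNullEquiv hx).symm a)
    rwa [Category.assoc, Category.assoc, redProjEq_π] at this

variable {Y}

omit [FullyReduced J] [HasZeroObject C] in
lemma IsReedyFibrant.fibration_of_eq (hY : Y.IsReedyFibrant) (s : TruncCat J n) {m : ℕ}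
    (h : deg s.obj = m) : Fibration (Y.matchingMap s m) := by
  subst h
  exact hY s

omit [FullyReduced J] [HasZeroObject C] in
lemma IsReedyFibrant.fibration_pi_map (hY : Y.IsReedyFibrant) (x : J) (m : ℕ) :
    Fibration (Limits.Pi.map fun g : NonNull n x (· = m) => Y.matchingMap g.tgt m) := by
  have := fun g : NonNull n x (· = m) => hY.fibration_of_eq g.tgt g.prop
  infer_instance

omit [FullyReduced J] [HasZeroObject C] in
lemma isZero_redMatching_zero (x : J) : IsZero (Y.redMatching x 0) := by
  have : IsEmpty (NonNull n x (· < 0)) := ⟨fun f => Nat.not_lt_zero _ f.prop⟩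
  exact (isZero_pi _ fun i => isEmptyElim i : IsZero (Y.prodNonNull x (· < 0))).of_mono
    (Y.redForget x 0)

/-- The reduced matching object of `s` is fibrant, being zero in degree zero and the fibre of a
product of matching fibrations otherwise; no induction on the degree is needed. -/
lemma IsReedyFibrant.fibration_zero (hY : Y.IsReedyFibrant) (s : TruncCat J n) :
    Fibration (0 : Y.obj s ⟶ (0 : C)) := by
  have := hY s
  have : Fibration (0 : Y.redMatching s.obj (deg s.obj) ⟶ (0 : C)) := by
    obtain ⟨m, hm⟩ : ∃ m, m = deg s.obj := ⟨_, rfl⟩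
    rw [← hm]
    cases m with
    | zero =>
      have : IsIso (0 : Y.redMatching s.obj 0 ⟶ (0 : C)) :=
        ⟨0, (isZero_redMatching_zero _).eq_of_src _ _, (isZero_zero C).eq_of_src _ _⟩
      infer_instance
    | succ m =>
      have := hY.fibration_pi_map s.obj m
      exact (Y.isKernelInclusion_redProjEq (by omega)).fibration_zero
  exact fibration_zero_of_fibration (Y.matchingMap s (deg s.obj))

end PointedDiagram

end Reduced

/-! ### Homotopy theory of a single grid -/

namespace SeparationGrid

variable {J : Type w} [SmallCategory J] [PointedIndexingCategory J] {n : ℕ}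
  {C : Type u} [Category.{v} C] [ModelCategory C] [HasZeroMorphisms C]
  {Y : PointedDiagram J n C} {x : J} {k : ℕ}
  {T : ∀ s : TruncCat J n, deg s.obj = k → SeparationTower Y s k} (G : SeparationGrid Y x k T)

lemma fibration_hor_of_le {j i : ℕ} (hj : j + 2 ≤ k) (hi : j + 1 ≤ i) (hik : i ≤ k + 1) :
    Fibration (G.hor j i) := by
  induction i, hi using Nat.le_induction with
  | base => exact G.fibration_hor j hj
  | succ i hi ih =>
    have := ih (by omega)
    rw [fibration_iff]
    exact MorphismProperty.of_isPullback (G.isPullback j i hj hi (by omega)).flip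
      (mem_fibrations (G.hor j i))

/-- The composite of the horizontal maps of a row. -/
def rowMap (i : ℕ) : ∀ j, G.F j i ⟶ G.F 0 i
  | 0 => 𝟙 _
  | j + 1 => G.hor j i ≫ rowMap i j

lemma fibration_rowMap {j i : ℕ} (hj : j + 1 ≤ k) (hi : j ≤ i) (hik : i ≤ k + 1) :
    Fibration (G.rowMap i j) := by
  induction j with
  | zero => exact inferInstanceAs (Fibration (𝟙 _))
  | succ j ih =>
    have := ih (by omega) (by omega)
    have := G.fibration_hor_of_le (j := j) (i := i) (by omega) hi hik
    exact inferInstanceAs (Fibration (G.hor j i ≫ G.rowMap i j))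

lemma isPullback_rowMap {j i : ℕ} (hj : j + 1 ≤ k) (hi : j ≤ i) (hik : i ≤ k) :
    IsPullback (G.rowMap (i + 1) j) (G.ver j i) (G.ver 0 i) (G.rowMap i j) := by
  induction j with
  | zero =>
    exact IsPullback.of_horiz_isIso (fst := 𝟙 _) (g := 𝟙 _)
      ⟨(Category.id_comp _).trans (Category.comp_id _).symm⟩
  | succ j ih => exact (G.isPullback j i hj hi hik).paste_horiz (ih (by omega) (by omega))

lemma p_rowMap {j : ℕ} (hj : j + 1 ≤ k) : G.p j ≫ G.rowMap (k + 1) j = G.p 0 := by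
  induction j with
  | zero => exact Category.comp_id _
  | succ j ih =>
    change G.p (j + 1) ≫ G.hor j (k + 1) ≫ G.rowMap (k + 1) j = _
    rw [← Category.assoc, G.p_hor j hj, ih (by omega)]

/-- A horizontal map of the grid is a pullback of each horizontal map below it. -/
lemma exists_isPullback_hor {j i i' : ℕ} (hj : j + 2 ≤ k) (hi : j + 1 ≤ i) (h : i ≤ i')
    (hik : i' ≤ k + 1) :
    ∃ (u : G.F (j + 1) i' ⟶ G.F (j + 1) i) (v : G.F j i' ⟶ G.F j i),
      IsPullback (G.hor j i') u v (G.hor j i) := by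
  induction i', h using Nat.le_induction with
  | base => exact ⟨𝟙 _, 𝟙 _, IsPullback.of_vert_isIso ⟨by rw [Category.id_comp, Category.comp_id]⟩⟩
  | succ i' h ih =>
    obtain ⟨u, v, hs⟩ := ih (by omega)
    exact ⟨_, _, (G.isPullback j i' hj (by omega) (by omega)).paste_vert hs⟩

variable [HasZeroObject C]

/-- The weak equivalences `ι` (for `j = 1`) and `q j j` (for `j ≥ 2`) have zero objects as sources.
-/
lemma isContractible_diag [FullyReduced J] (hx : k < deg x) {j : ℕ} (hj : 1 ≤ j) (hjk : j + 1 ≤ k) :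
    IsContractible (G.F j j) := by
  rcases Nat.eq_or_lt_of_le hj with rfl | hj
  · have := G.weakEquivalence_ι
    have := isEmpty_nonNull_lt (n := n) hx
    exact .of_isZero (isZero_pi _ fun i => isEmptyElim i) G.ι
  · have := G.weakEquivalence_q j hj hjk
    exact .of_isZero (Y.isZero_Q hx) (G.q j j)

lemma fibration_zero_of_isLimit {ι : Type*} [Finite ι] {Z : ι → C} {A : C} {π : ∀ i, A ⟶ Z i}
    (h : Nonempty (IsLimit (Fan.mk A π))) (hZ : ∀ i, Fibration (0 : Z i ⟶ (0 : C))) :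
    Fibration (0 : A ⟶ (0 : C)) := by
  have := isIso_lift_of_isLimit h
  have := fibration_zero_pi Z hZ
  exact fibration_zero_of_fibration (Pi.lift π)

/-- Top-row entries are the tower stages used in the grids one stage higher, which is where their
fibrancy is needed. -/
lemma fibration_zero_top (hY : Y.IsReedyFibrant) [FullyReduced J] {j : ℕ} (hj : j + 1 ≤ k) :
    Fibration (0 : G.F j (k + 1) ⟶ (0 : C)) := by
  have := fibration_zero_of_isLimit G.isLimit_projY fun g => hY.fibration_zero g.tgt
  have := G.fibration_rowMap (i := k + 1) hj (by omega) le_rfl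
  exact fibration_zero_of_fibration (G.rowMap (k + 1) j)

lemma fibration_zero_diag [FullyReduced J] (hY : Y.IsReedyFibrant)
    (hT : ∀ s hs r, r + 2 ≤ k → Fibration (0 : (T s hs).obj r ⟶ (0 : C)))
    {j : ℕ} (hj : 1 ≤ j) (hjk : j + 1 ≤ k) : Fibration (0 : G.F j j ⟶ (0 : C)) := by
  have : Fibration (0 : G.F 0 j ⟶ (0 : C)) := by
    obtain ⟨r, rfl⟩ : ∃ r, j = r + 1 := ⟨j - 1, by omega⟩
    cases r with
    | zero =>
      exact fibration_zero_of_isLimit G.isLimit_proj_one fun p => hY.fibration_zero _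
    | succ r =>
      exact fibration_zero_of_isLimit (G.isLimit_projT (r + 1) (by omega) (by omega))
        fun g => hT _ _ _ (by omega)
  have := G.fibration_rowMap (i := j) hjk le_rfl (by omega)
  exact fibration_zero_of_fibration (G.rowMap j j)

lemma trivialFibrations_diag [FullyReduced J] (hY : Y.IsReedyFibrant) (hx : k < deg x)
    (hT : ∀ s hs r, r + 2 ≤ k → Fibration (0 : (T s hs).obj r ⟶ (0 : C)))
    {j : ℕ} (hj : 1 ≤ j) (hjk : j + 1 ≤ k) : trivialFibrations C (0 : G.F j j ⟶ (0 : C)) := by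
  have := G.fibration_zero_diag hY hT hj hjk
  exact (G.isContractible_diag hx hj hjk).trivialFibrations

/-- The top vertical map of column `0` is a fibration whose fibre is the reduced matching
object. -/
lemma isKernelInclusion_ver_zero [FullyReduced J] (hx : k < deg x) :
    IsKernelInclusion (Y.redMatchingToP x k ≫ G.p 0) (G.ver 0 k) := by
  have := isIso_lift_of_isLimit G.isLimit_projY
  have := isIso_lift_of_isLimit G.isLimit_projM
  refine .of_isIso (Pi.lift G.projY) (Pi.lift G.projM)
    (p' := Limits.Pi.map fun g : NonNull n x (· = k) => Y.matchingMap g.tgt k) ?_ ?_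
  · refine Pi.hom_ext _ _ fun g => ?_
    rw [Category.assoc, Category.assoc, Limits.Pi.map_π, Pi.lift_π, Pi.lift_π_assoc, G.ver_projM]
  · have e : (Y.redMatchingToP x k ≫ G.p 0) ≫ Pi.lift G.projY = Y.redProjEq x k := by
      refine Pi.hom_ext _ _ fun g => ?_
      rw [Category.assoc, Category.assoc, Pi.lift_π, G.p_projY, Y.redProjEq_π,
        PointedDiagram.PProj, PointedDiagram.redMatchingToP, pullback.lift_snd_assoc, Pi.lift_π]
    rw [e]
    exact Y.isKernelInclusion_redProjEq hx

omit [HasZeroObject C] in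
lemma fibration_ver_zero (hY : Y.IsReedyFibrant) : Fibration (G.ver 0 k) := by
  have := isIso_lift_of_isLimit G.isLimit_projY
  have := isIso_lift_of_isLimit G.isLimit_projM
  have := hY.fibration_pi_map x k
  have e : G.ver 0 k = Pi.lift G.projY ≫
      (Limits.Pi.map fun g : NonNull n x (· = k) => Y.matchingMap g.tgt k) ≫
        inv (Pi.lift G.projM) := by
    rw [← Category.assoc, IsIso.eq_comp_inv]
    refine Pi.hom_ext _ _ fun g => ?_
    rw [Category.assoc, Category.assoc, Limits.Pi.map_π, Pi.lift_π, Pi.lift_π_assoc, G.ver_projM]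
  rw [e]
  infer_instance

/-- The vertical maps between the two top rows are base changes of the one in column zero, so they
all have the same fibre. -/
lemma isKernelInclusion_ver [FullyReduced J] (hx : k < deg x) {j : ℕ} (hj : j + 1 ≤ k) :
    IsKernelInclusion (Y.redMatchingToP x k ≫ G.p j) (G.ver j k) := by
  refine .of_isPullback (G.isPullback_rowMap hj (by omega) le_rfl) ?_ ?_
  · rw [Category.assoc, G.p_rowMap hj]
    exact G.isKernelInclusion_ver_zero hx
  · rw [Category.assoc, G.p_ver j hj, (Y.isZero_Q hx).eq_zero_of_tgt (Y.PToQ x k), zero_comp,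
      comp_zero]

omit [HasZeroObject C] in
lemma fibration_ver (hY : Y.IsReedyFibrant) {j : ℕ} (hj : j + 1 ≤ k) : Fibration (G.ver j k) := by
  rw [fibration_iff]
  have := G.fibration_ver_zero hY
  exact MorphismProperty.of_isPullback (G.isPullback_rowMap hj (by omega) le_rfl)
    (mem_fibrations (G.ver 0 k))

/-- An off-diagonal object of the grid over a pullback square of column `0` whose right-hand side is
a fibration from a contractible object. -/
lemma trivialFibrationSpan_of_isPullback [FullyReduced J] (hY : Y.IsReedyFibrant) (hx : k < deg x)
    (hT : ∀ s hs r, r + 2 ≤ k → Fibration (0 : (T s hs).obj r ⟶ (0 : C)))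
    {j : ℕ} (hj : 1 ≤ j) (hjk : j + 1 ≤ k) {P B : C} {a : G.F 0 (j + 1) ⟶ P} {p : P ⟶ B}
    {c : G.F 0 j ⟶ B} (h : IsPullback a (G.ver 0 j) p c) [Fibration p] (hP : IsContractible P) :
    TrivialFibrationSpan (G.F j (j + 1)) (loopObj B) :=
  trivialFibrationSpan_loopObj_of_isPullback
    ((G.isPullback_rowMap hjk le_rfl (by omega)).paste_horiz h)
    hP (G.trivialFibrations_diag hY hx hT hj hjk)

/-- An off-diagonal object of the grid over a fibre sequence of column `0`. -/
lemma trivialFibrationSpan_of_isKernelInclusion [FullyReduced J] (hx : k < deg x)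
    {j : ℕ} (hj : 1 ≤ j) (hjk : j + 1 ≤ k) {B : C} {c : G.F 0 j ⟶ B}
    (h : IsKernelInclusion (G.ver 0 j) c) [Fibration c] :
    TrivialFibrationSpan (G.F j (j + 1)) (loopObj B) := by
  have := G.fibration_rowMap (i := j) hjk le_rfl (by omega)
  -- `F j (j + 1)` is the fibre of the composite fibration `F j j ⟶ F 0 j ⟶ B`.
  exact (G.isContractible_diag hx hj hjk).trivialFibrationSpan_loopObj
    (h.of_isPullback_comp (G.isPullback_rowMap hjk le_rfl (by omega)))

end SeparationGrid

/-! ### Inversion and fibrancy of separation towers -/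

section Towers

variable {J : Type w} [SmallCategory J] [PointedIndexingCategory J] [FullyReduced J] {n : ℕ}
  {C : Type u} [Category.{v} C] [ModelCategory C] [HasZeroMorphisms C]
  {Y : PointedDiagram J n C}

lemma IsSeparationTower.eq_base {s : TruncCat J n} {t : SeparationTower Y s 2}
    (h : IsSeparationTower Y 2 s t) : t = SeparationTower.base Y s := by
  cases h with
  | base s hs => rfl
  | step k hk => omega

lemma IsSeparationTower.exists_grid {k : ℕ} (hk : 2 ≤ k) {s : TruncCat J n}
    {t : SeparationTower Y s (k + 1)} (h : IsSeparationTower Y (k + 1) s t) :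
    ∃ (hs : deg s.obj = k + 1)
      (T : ∀ u : TruncCat J n, deg u.obj = k → SeparationTower Y u k)
      (_ : ∀ u hu, IsSeparationTower Y k u (T u hu)) (G : SeparationGrid Y s.obj k T),
      t = G.topRow hs := by
  cases h with
  | base s hs => omega
  | step k hk s hs T hT G => exact ⟨hs, T, hT, G, rfl⟩

lemma IsSeparationTower.fibration_zero [HasZeroObject C] (hY : Y.IsReedyFibrant) {k : ℕ}
    {s : TruncCat J n} {t : SeparationTower Y s k} (h : IsSeparationTower Y k s t) {r : ℕ}
    (hr : r + 2 ≤ k) : Fibration (0 : t.obj r ⟶ (0 : C)) := by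
  cases h with
  | base s hs => exact fibration_zero_pi _ fun f => hY.fibration_zero f.tgt
  | step k hk s hs T hT G => exact G.fibration_zero_top hY (by omega)

end Towers

/-! ### Products of loop objects over strings -/

section Strings

variable {J : Type w} [SmallCategory J] [PointedIndexingCategory J] {n : ℕ}
  {C : Type u} [Category.{v} C] [ModelCategory C] [HasZeroMorphisms C]
  (Y : PointedDiagram J n C)

variable [HasZeroObject C]

variable (n) in
/-- The product of the `m`-fold loop objects over the strings starting at `x`. -/
abbrev loopProd (m l k : ℕ) (x : J) : C :=
  ∏ᶜ fun σ : NonNullString n l k x => loopObj^[m] (Y.obj σ.target)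

/-- A longer string is a first arrow followed by a string from its target, so the double product is
a single one. -/
lemma trivialFibrationSpan_loopProd_succ {m l k : ℕ} {x : J}
    {Z : NonNull n x (· = k + 1) → C}
    (h : ∀ g, TrivialFibrationSpan (Z g) (loopProd n Y m l k g.tgt.obj)) :
    TrivialFibrationSpan (∏ᶜ Z) (loopProd n Y m (l + 1) (k + 1) x) :=
  (TrivialFibrationSpan.pi h).trans (.of_iso (piPiIso
    (fun g : NonNull n x (· = k + 1) => NonNullString n l k g.tgt.obj)
    (fun (g : NonNull n x (· = k + 1)) (σ : NonNullString n l k g.tgt.obj) =>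
      loopObj^[m] (Y.obj σ.target))))

variable {Y}

lemma trivialFibrationSpan_loopObj_loopProd [FullyReduced J] (hY : Y.IsReedyFibrant) {m l k : ℕ}
    {x : J} {Z : C} (h : TrivialFibrationSpan Z (loopProd n Y m l k x)) :
    TrivialFibrationSpan (loopObj Z) (loopProd n Y (m + 1) l k x) := by
  refine h.loopObj.trans ((trivialFibrationSpan_loopObj_pi _ fun σ => ?_).trans ?_)
  · have := hY.fibration_zero σ.target
    exact fibration_zero_loopObj_iterate m
  · refine .pi fun σ => .of_iso (eqToIso ?_)
    exact (Function.iterate_succ_apply' loopObj m _).symm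

end Strings

/-! ### The induction on columns -/

section Main

variable {J : Type w} [SmallCategory J] [PointedIndexingCategory J] [FullyReduced J] {n : ℕ}
  {C : Type u} [Category.{v} C] [ModelCategory C] [HasZeroMorphisms C]
  {Y : PointedDiagram J n C}

omit [ModelCategory C] in
lemma nonempty_isLimit_fan_lt {x : J} {m : ℕ} (hx : m < deg x) {A : C}
    {π : ∀ g : NonNull n x (· = m), A ⟶ Y.obj g.tgt} (h : Nonempty (IsLimit (Fan.mk A π))) :
    Nonempty (IsLimit (Fan.mk A (fun f : NonNull n x (· < m + 1) =>
      (π ((nonNullEquiv hx).symm f) : A ⟶ Y.obj f.tgt)))) :=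
  ⟨Fan.IsLimit.mk _
    (fun s => Fan.IsLimit.lift h.some fun g => (s.proj (nonNullEquiv hx g) : s.pt ⟶ Y.obj g.tgt))
    (fun _ f => Fan.IsLimit.fac h.some _ ((nonNullEquiv hx).symm f))
    (fun s _ hl => Fan.IsLimit.hom_ext h.some _ _ fun g =>
      (hl (nonNullEquiv hx g)).trans
        (Fan.IsLimit.fac h.some (fun g => (s.proj (nonNullEquiv hx g) : s.pt ⟶ Y.obj g.tgt)) g).symm)⟩

omit [ModelCategory C] in
lemma nonempty_isLimit_fan_eq {x : J} {m : ℕ} (hx : m < deg x) {A : C}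
    {π : ∀ g : NonNull n x (· < m + 1), A ⟶ Y.obj g.tgt} (h : Nonempty (IsLimit (Fan.mk A π))) :
    Nonempty (IsLimit (Fan.mk A (fun f : NonNull n x (· = m) =>
      (π (nonNullEquiv hx f) : A ⟶ Y.obj f.tgt)))) :=
  ⟨Fan.IsLimit.mk _
    (fun s => Fan.IsLimit.lift h.some fun g =>
      (s.proj ((nonNullEquiv hx).symm g) : s.pt ⟶ Y.obj g.tgt))
    (fun _ f => Fan.IsLimit.fac h.some _ (nonNullEquiv hx f))
    (fun s _ hl => Fan.IsLimit.hom_ext h.some _ _ fun g =>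
      (hl ((nonNullEquiv hx).symm g)).trans (Fan.IsLimit.fac h.some
        (fun g => (s.proj ((nonNullEquiv hx).symm g) : s.pt ⟶ Y.obj g.tgt)) g).symm)⟩

lemma IsSeparationTower.nonempty_isLimit_legs {k : ℕ} {s : TruncCat J n}
    {t : SeparationTower Y s k} (h : IsSeparationTower Y k s t) :
    Nonempty (IsLimit (Fan.mk (t.obj 0) t.legs)) := by
  cases h with
  | base s hs => exact ⟨productIsProduct _⟩
  | step k hk s hs T hT G => exact nonempty_isLimit_fan_lt (by omega) G.isLimit_projY

namespace SeparationGrid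

variable {x : J} {k : ℕ}
  {T : ∀ s : TruncCat J n, deg s.obj = k → SeparationTower Y s k} (G : SeparationGrid Y x k T)

/-- For `r = 0` the grid prescribes only a product over pairs of arrows; it splits into fibrewise
products because the legs of each tower form a product. -/
lemma nonempty_isLimit_projT (hT : ∀ s hs, IsSeparationTower Y k s (T s hs)) {r : ℕ}
    (hr : r + 2 ≤ k) :
    Nonempty (IsLimit (Fan.mk (G.F 0 (r + 1)) fun g => G.projT g r)) := by
  cases r with
  | zero => exact nonempty_isLimit_fan_of_sigma G.isLimit_proj_one fun g =>
      (hT g.tgt g.prop).nonempty_isLimit_legs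
  | succ r => exact G.isLimit_projT (r + 1) (by omega) hr

variable [HasZeroObject C]

lemma trivialFibrationSpan_zero {m : ℕ}
    {T : ∀ s : TruncCat J n, deg s.obj = m + 1 → SeparationTower Y s (m + 1)}
    (G : SeparationGrid Y x (m + 1) T) (hm : 1 ≤ m)
    (hT : ∀ s hs, IsSeparationTower Y (m + 1) s (T s hs)) :
    TrivialFibrationSpan (G.F 0 1) (loopProd n Y 0 1 (m + 1) x) := by
  have := isIso_lift_of_isLimit (G.nonempty_isLimit_projT hT (r := 0) (by omega))
  refine (TrivialFibrationSpan.of_iso (asIso (Pi.lift fun g => G.projT g 0))).trans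
    (trivialFibrationSpan_loopProd_succ Y fun g => ?_)
  have hg : deg g.tgt.obj = m + 1 := g.prop
  have := isIso_lift_of_isLimit (nonempty_isLimit_fan_eq (m := m) (by omega)
    (hT g.tgt g.prop).nonempty_isLimit_legs)
  exact .of_iso (@asIso _ _ _ _ _ this)

end SeparationGrid

variable [HasZeroObject C]

/-- There are no targets of negative degree, so the kernel presentation has zero target and its
inclusion is an isomorphism. -/
lemma trivialFibrationSpan_redMatching_one {x : J} (hx : 0 < deg x) :
    TrivialFibrationSpan (Y.redMatching x 1) (loopProd n Y 0 0 0 x) := by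
  have h := Y.isKernelInclusion_redProjEq (m := 0) hx
  have hz : IsZero (∏ᶜ fun g : NonNull n x (· = 0) => Y.redMatching g.tgt.obj 0) :=
    isZero_pi _ fun g => PointedDiagram.isZero_redMatching_zero _
  have := h.mono
  obtain ⟨l, hl⟩ := h.exists_lift (𝟙 _) (hz.eq_of_tgt _ _)
  have : IsIso (Y.redProjEq x 0) :=
    ⟨l, by rw [← cancel_mono (Y.redProjEq x 0), Category.assoc, hl, Category.comp_id,
      Category.id_comp], hl⟩
  have e := asIso (Y.redProjEq x 0)
  exact .of_iso e

lemma isKernelInclusion_redForget {x : J} {m : ℕ} (hx : m < deg x) :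
    ∃ ρ : Y.prodNonNull x (· < m + 1) ⟶ ∏ᶜ fun g : NonNull n x (· = m) => Y.obj g.tgt,
      IsIso ρ ∧ IsKernelInclusion (Y.redForget x (m + 1))
        (ρ ≫ Limits.Pi.map fun g : NonNull n x (· = m) => Y.matchingMap g.tgt m) := by
  let ρ : Y.prodNonNull x (· < m + 1) ⟶ ∏ᶜ fun g : NonNull n x (· = m) => Y.obj g.tgt :=
    Pi.lift fun f => Pi.π (fun f : NonNull n x (· < m + 1) => Y.obj f.tgt) (nonNullEquiv hx f)
  have : IsIso ρ := isIso_lift_of_isLimit (nonempty_isLimit_fan_eq hx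
    ⟨productIsProduct fun f : NonNull n x (· < m + 1) => Y.obj f.tgt⟩)
  refine ⟨ρ, this, .of_isIso ρ (𝟙 _) (Category.comp_id _).symm ?_⟩
  have e : Y.redForget x (m + 1) ≫ ρ = Y.redProjEq x m := by
    refine Pi.hom_ext _ _ fun g => ?_
    have hρ : ρ ≫ Pi.π (fun g : NonNull n x (· = m) => Y.obj g.tgt) g =
        Pi.π (fun f : NonNull n x (· < m + 1) => Y.obj f.tgt) (nonNullEquiv hx g) := Pi.lift_π _ _
    rw [Category.assoc, hρ, Y.redProjEq_π, PointedDiagram.redProj,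
      PointedDiagram.proj_toArr]
    rfl
  rw [e]
  exact Y.isKernelInclusion_redProjEq hx

/-- The last stage of a tower is the total object of a fibration with fibre the reduced matching
object. -/
lemma IsSeparationTower.exists_isKernelInclusion (hY : Y.IsReedyFibrant) {m : ℕ}
    {s : TruncCat J n} (hs : deg s.obj = m + 2) {t : SeparationTower Y s (m + 2)}
    (h : IsSeparationTower Y (m + 2) s t)
    (ih : ∀ (T : ∀ s : TruncCat J n, deg s.obj = m + 1 → SeparationTower Y s (m + 1))
      (_ : ∀ s hs, IsSeparationTower Y (m + 1) s (T s hs)) (G : SeparationGrid Y s.obj (m + 1) T),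
      2 ≤ m + 1 → TrivialFibrationSpan (G.F m (m + 1)) (loopProd n Y m (m + 1) (m + 1) s.obj)) :
    ∃ (B : C) (c : t.obj m ⟶ B), Fibration c ∧ IsKernelInclusion (t.top m) c ∧
      TrivialFibrationSpan B (loopProd n Y m (m + 1) (m + 1) s.obj) := by
  -- Stage two has no grid below it: there the tower is the bare inclusion, and `B` is a product of
  -- reduced matching objects of degree-one objects. At higher stages `c` is a vertical map of the
  -- grid for `s`, and `ih` identifies its target.
  cases m with
  | zero =>
    obtain rfl := h.eq_base
    obtain ⟨ρ, hρ, hk⟩ := isKernelInclusion_redForget (Y := Y) (x := s.obj) (m := 1) (by omega)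
    have := hY.fibration_pi_map s.obj 1
    refine ⟨_, _, (inferInstance : Fibration (ρ ≫ Limits.Pi.map _)), hk,
      trivialFibrationSpan_loopProd_succ Y fun g => trivialFibrationSpan_redMatching_one ?_⟩
    have hg : deg g.tgt.obj = 1 := g.prop
    omega
  | succ m =>
    obtain ⟨hs', T, hT, G, rfl⟩ := h.exists_grid (by omega)
    exact ⟨_, G.ver (m + 1) (m + 2), G.fibration_ver hY (by omega),
      G.isKernelInclusion_ver (by omega) (by omega), ih T hT G (by omega)⟩

/-- `k`, `x`, the towers and the grid vary with `j`, since the induction passes from `(x, k)` to the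
pairs `(s, k - 1)` and their own grids. -/
theorem SeparationGrid.trivialFibrationSpan_loopProd (hY : Y.IsReedyFibrant) (j : ℕ) :
    ∀ {k : ℕ} {x : J} {T : ∀ s : TruncCat J n, deg s.obj = k → SeparationTower Y s k}
      (_ : ∀ s hs, IsSeparationTower Y k s (T s hs)) (G : SeparationGrid Y x k T),
      2 ≤ k → j + 1 ≤ k → k < deg x →
        TrivialFibrationSpan (G.F j (j + 1)) (loopProd n Y j (j + 1) k x) := by
  induction j with
  | zero =>
    intro k x T hT G hk _ hx
    obtain ⟨m, rfl⟩ : ∃ m, k = m + 1 := ⟨k - 1, by omega⟩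
    exact G.trivialFibrationSpan_zero (by omega) hT
  | succ j ih =>
    intro k x T hT G hk hjk hx
    have hfib := fun s hs r hr => (hT s hs).fibration_zero hY (r := r) hr
    rcases Nat.eq_or_lt_of_le hjk with rfl | hlt
    -- Last column, `k = j + 2`: the column-zero map starts at the product of the reduced matching
    -- objects and is the fibre inclusion of a fibration.
    · have hB := fun g : NonNull n x (· = j + 2) =>
        (hT g.tgt g.prop).exists_isKernelInclusion hY g.prop fun T' hT' G' hj =>
          ih hT' G' hj le_rfl (by have : deg g.tgt.obj = j + 2 := g.prop; omega)
      choose B c hc hi hB using hB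
      have hA := G.nonempty_isLimit_projT hT (r := j) (by omega)
      have := isIso_lift_of_isLimit hA
      have hker : IsKernelInclusion (G.ver 0 (j + 1)) (Pi.lift fun g => G.projT g j ≫ c g) :=
        isKernelInclusion_fan hA G.isLimit_projM hi fun g => by
          rw [G.ver_projT_top g j rfl, eqToHom_refl, Category.id_comp]
      have hfibc : Fibration (Pi.lift fun g => G.projT g j ≫ c g) := by
        have e : (Pi.lift fun g => G.projT g j ≫ c g) =
            Pi.lift (fun g => G.projT g j) ≫ Limits.Pi.map c :=
          Pi.hom_ext _ _ fun g => by simp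
        rw [e]
        infer_instance
      exact (G.trivialFibrationSpan_of_isKernelInclusion hx (by omega) (by omega) hker).trans
        (trivialFibrationSpan_loopObj_loopProd hY (trivialFibrationSpan_loopProd_succ Y hB))
    -- Earlier columns: here `k ≥ 3`, so every tower is the top row of a grid for `s` at stage `m =
    -- k - 1`.
    · obtain ⟨m, rfl⟩ : ∃ m, k = m + 1 := ⟨k - 1, by omega⟩
      have hm : 2 ≤ m := by omega
      choose hs T' hT' G' hG' using fun s hs => (hT s hs).exists_grid hm
      obtain rfl : T = fun s hs => (G' s hs).topRow hs := funext fun s => funext fun hs => hG' s hs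
      have hd (g : NonNull n x (· = m + 1)) : m < deg g.tgt.obj := by
        have : deg g.tgt.obj = m + 1 := g.prop
        omega
      have hA := G.nonempty_isLimit_projT hT (r := j) (by omega)
      have hA' := G.nonempty_isLimit_projT hT (r := j + 1) (by omega)
      -- Descending from the top row to row `j + 1` replaces the source of each map by the
      -- contractible diagonal entry, and its target by the entry covered by `ih`.
      have hsq := fun g : NonNull n x (· = m + 1) =>
        (G' g.tgt g.prop).exists_isPullback_hor (j := j) (i := j + 1) (i' := m + 1)
          (by omega) le_rfl (by omega) le_rfl
      choose u v hsq using hsq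
      have hpb := isPullback_pi hA hA' (fun g => (hsq g).flip)
        (fun g => G.ver_projT g j (by omega))
      have hfibp : ∀ g : NonNull n x (· = m + 1), Fibration ((G' g.tgt g.prop).hor j (j + 1)) :=
        fun g => (G' g.tgt g.prop).fibration_hor j (by omega)
      refine (G.trivialFibrationSpan_of_isPullback hY hx hfib (by omega) (by omega) hpb
        (.pi (fun g => (G' g.tgt g.prop).isContractible_diag (hd g) (by omega) (by omega))
          fun g => (G' g.tgt g.prop).fibration_zero_diag hY
            (fun s hs r hr => (hT' _ _ s hs).fibration_zero hY hr) (by omega) (by omega))).trans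
        (trivialFibrationSpan_loopObj_loopProd hY (trivialFibrationSpan_loopProd_succ Y fun g =>
          ih (hT' _ _) (G' g.tgt g.prop) hm (by omega) (hd g)))

end Main

end

theorem mainTheorem6 {J : Type w} [SmallCategory J] [PointedIndexingCategory J] [FullyReduced J]
    {C : Type u} [Category.{v} C] [ModelCategory C] [HasZeroObject C] [HasZeroMorphisms C]
    {n k j : ℕ} (hj : 2 ≤ j) (hjk : j ≤ k) (hkn : k ≤ n)
    (Y : PointedDiagram J n C) (hY : Y.IsReedyFibrant)
    (x : J) (hx : n < PointedIndexingCategory.deg x)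
    (T : ∀ s : TruncCat J n, PointedIndexingCategory.deg s.obj = k → SeparationTower Y s k)
    (hT : ∀ s hs, IsSeparationTower Y k s (T s hs))
    (G : SeparationGrid Y x k T) :
    WeaklyEquivalent (G.F (j - 1) j)
      (∏ᶜ fun σ : NonNullString n j k x => loopObj^[j - 1] (Y.obj σ.target)) := by
  obtain ⟨i, rfl⟩ : ∃ i, j = i + 1 := ⟨j - 1, by omega⟩
  exact (G.trivialFibrationSpan_loopProd hY i hT (by omega) hjk (by omega)).weaklyEquivalent
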